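/- Theorem 2.2 (planar spider theorem, special case). Let $A$ be an object of a monoidal category with unit object $\underline{1}$. A *special Frobenius algebra* structure on $A$ consists of an associative product $\mu:A\otimes A\to A$ with two-sided unit $1:\underline{1}\to A$ and a coassociative coproduct $\Delta:A\to A\otimes A$ with two-sided counit $\epsilon:A\to\underline{1}$ such that $$(\mu\otimes\mathrm{id}_A)\circ(\mathrm{id}_A\otimes\Delta)=\Delta\circ\mu=(\mathrm{id}_A\otimes\mu)\circ(\Delta\otimes\mathrm{id}_A),\qquad \mu\circ\Delta=\mathrm{id}_A .$$ Given morphisms $\cup:A\otimes A\to\underline{1}$, $\cap:\underline{1}\to A\otimes A$, $\mu:A\otimes A\to A$, $\Delta:A\to A\otimes A$, a *planar diagram* with $m$ legs in and $n$ legs out is a formal composite built from the four operations and vertical strands by vertical composition and horizontal juxtaposition; it represents a morphism $A^{\otimes m}\to A^{\otimes n}$ (canonical associativity and unit isomorphisms being understood). It is *connected* if it is non-empty and its underlying graph, whose vertices are the operations and the strands, is connected. The *standard form* for $(m,n)$ is the morphism $$(\mathrm{id}_A^{\otimes n-2}\otimes\Delta)\circ\cdots\circ(\mathrm{id}_A\otimes\Delta)\circ\Delta\circ\mu\circ(\mathrm{id}_A\otimes\mu)\circ\cdots\circ(\mathrm{id}_A^{\otimes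 m-2}\otimes\mu):A^{\otimes m}\to A^{\otimes n},$$ that is, an $(m-1)$-fold product followed by an $(n-1)$-fold coproduct (each of them being $\mathrm{id}_A$ if $m=1$, respectively $n=1$), where for $m=0$ the product part is replaced by $\mu\circ\cap:\underline{1}\to A$ and for $n=0$ the coproduct part is replaced by $\cup\circ\Delta:A\to\underline{1}$. Then special Frobenius algebra structures on $A$ are equivalent to specifications of morphisms $\cup,\cap,\mu,\Delta$ as above such that, for all integers $m,n\ge 0$, every morphism represented by a connected planar diagram with $m$ legs in and $n$ legs out equals the standard form for $(m,n)$. More precisely, the assignment $$(\mu,1,\Delta,\epsilon)\longmapsto(\cup,\cap,\mu,\Delta),\qquad \cup=\epsilon\circ\mu,\quad \cap=\Delta\circ 1,$$ is a bijection from the former to the latter, with inverse given by the same $\mu$ and $\Delta$ together with $1=\mu\circ\cap$ and $\epsilon=\cup\circ\Delta$. -/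

import Mathlib

open CategoryTheory MonoidalCategory

universe v u

/-- A special Frobenius algebra structure on an object `A` of a monoidal category, in the
algebra-coalgebra form: a monoid structure `(mul, one)` (associative and unital product) and a
comonoid structure `(comul, counit)` (coassociative and counital coproduct) such that
`(mul ⊗ id) ∘ (id ⊗ comul) = comul ∘ mul = (id ⊗ mul) ∘ (comul ⊗ id)` and
`mul ∘ comul = id`. No symmetry or commutativity is required. -/
structure SpecialFrobeniusStructure {C : Type u} [Category.{v} C] [MonoidalCategory C] (A : C)
    extends MonObj A, ComonObj A where
  frobenius_left : A ◁ comul ≫ (α_ A A A).inv ≫ mul ▷ A = mul ≫ comul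
  frobenius_right : comul ▷ A ≫ (α_ A A A).hom ≫ A ◁ mul = mul ≫ comul
  special : comul ≫ mul = 𝟙 A

/-- A specification of four morphisms: a cup `A ⊗ A ⟶ 𝟙`, a cap `𝟙 ⟶ A ⊗ A`,
a product and a coproduct (diagrams are read from top to bottom), subject to no conditions. -/
@[ext]
structure SpiderOperations {C : Type u} [Category.{v} C] [MonoidalCategory C] (A : C) where
  cup : A ⊗ A ⟶ 𝟙_ C
  cap : 𝟙_ C ⟶ A ⊗ A
  prod : A ⊗ A ⟶ A
  coprod : A ⟶ A ⊗ A

/-- Planar diagrams with `m` legs in and `n` legs out, built from the four operations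
and parallel vertical strands by vertical composition and horizontal juxtaposition.
`strands 0` is the empty diagram. -/
inductive PlanarDiagram : ℕ → ℕ → Type
  | strands (n : ℕ) : PlanarDiagram n n
  | cup : PlanarDiagram 2 0
  | cap : PlanarDiagram 0 2
  | prod : PlanarDiagram 2 1
  | coprod : PlanarDiagram 1 2
  | comp {m k n : ℕ} (d : PlanarDiagram m k) (e : PlanarDiagram k n) : PlanarDiagram m n
  | juxt {m n m' n' : ℕ} (d : PlanarDiagram m n) (e : PlanarDiagram m' n') :
      PlanarDiagram (m + m') (n + n')

namespace PlanarDiagram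

/-- The vertices of the graph underlying a diagram: one for each occurrence of an operation,
and one for each strand of each piece `strands n`. -/
abbrev Vertex {m n : ℕ} : PlanarDiagram m n → Type
  | strands n => Fin n
  | cup => Unit
  | cap => Unit
  | prod => Unit
  | coprod => Unit
  | comp d e => d.Vertex ⊕ e.Vertex
  | juxt d e => d.Vertex ⊕ e.Vertex

/-- The vertex to which each leg in is attached, the legs being numbered from left to right. -/
def legIn {m n : ℕ} : (d : PlanarDiagram m n) → Fin m → d.Vertex
  | strands _ => fun i => i
  | cup => fun _ => ()
  | cap => fun _ => ()
  | prod => fun _ => ()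
  | coprod => fun _ => ()
  | comp d _ => fun i => Sum.inl (d.legIn i)
  | juxt d e => fun i => Sum.map d.legIn e.legIn (finSumFinEquiv.symm i)

/-- The vertex to which each leg out is attached, the legs being numbered from left to right. -/
def legOut {m n : ℕ} : (d : PlanarDiagram m n) → Fin n → d.Vertex
  | strands _ => fun i => i
  | cup => fun _ => ()
  | cap => fun _ => ()
  | prod => fun _ => ()
  | coprod => fun _ => ()
  | comp _ e => fun i => Sum.inr (e.legOut i)
  | juxt d e => fun i => Sum.map d.legOut e.legOut (finSumFinEquiv.symm i)

/-- The links between vertices: composing two diagrams vertically joins the `i`-th leg out of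
the upper one to the `i`-th leg in of the lower one. -/
def Link {m n : ℕ} : (d : PlanarDiagram m n) → d.Vertex → d.Vertex → Prop
  | strands _ => fun _ _ => False
  | cup => fun _ _ => False
  | cap => fun _ _ => False
  | prod => fun _ _ => False
  | coprod => fun _ _ => False
  | comp d e => fun x y =>
      Sum.LiftRel d.Link e.Link x y ∨
        ∃ i, x = Sum.inl (d.legOut i) ∧ y = Sum.inr (e.legIn i)
  | juxt d e => Sum.LiftRel d.Link e.Link

/-- A diagram is connected if its underlying graph is (in particular it is not empty). -/
def IsConnected {m n : ℕ} (d : PlanarDiagram m n) : Prop :=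
  (SimpleGraph.fromRel d.Link).Connected

end PlanarDiagram

section TensorPower

variable {C : Type u} [Category.{v} C] [MonoidalCategory C]

/-- The tensor power `A ⊗ ⋯ ⊗ A` with `n` factors, bracketed to the left. -/
abbrev tensorPow (A : C) : ℕ → C
  | 0 => 𝟙_ C
  | n + 1 => tensorPow A n ⊗ A

/-- The canonical isomorphism that removes the inner brackets. -/
def tensorPowAdd (A : C) (m : ℕ) :
    (n : ℕ) → (tensorPow A m ⊗ tensorPow A n ≅ tensorPow A (m + n))
  | 0 => ρ_ (tensorPow A m)
  | n + 1 => (α_ (tensorPow A m) (tensorPow A n) A).symm ≪≫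
      whiskerRightIso (tensorPowAdd A m n) A

/-- The canonical isomorphism from the first tensor power. -/
def tensorPowOne (A : C) : tensorPow A 1 ≅ A := λ_ A

/-- The canonical isomorphism from the second tensor power. -/
def tensorPowTwo (A : C) : tensorPow A 2 ≅ A ⊗ A := whiskerRightIso (λ_ A) A

end TensorPower

namespace SpiderOperations

variable {C : Type u} [Category.{v} C] [MonoidalCategory C] {A : C}

/-- The morphism represented by a planar diagram. -/
def eval (S : SpiderOperations A) {m n : ℕ} :
    PlanarDiagram m n → (tensorPow A m ⟶ tensorPow A n)
  | .strands n => 𝟙 (tensorPow A n)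
  | .cup => (tensorPowTwo A).hom ≫ S.cup
  | .cap => S.cap ≫ (tensorPowTwo A).inv
  | .prod => (tensorPowTwo A).hom ≫ S.prod ≫ (tensorPowOne A).inv
  | .coprod => (tensorPowOne A).hom ≫ S.coprod ≫ (tensorPowTwo A).inv
  | .comp d e => S.eval d ≫ S.eval e
  | .juxt d e => (tensorPowAdd A _ _).inv ≫ (S.eval d ⊗ₘ S.eval e) ≫ (tensorPowAdd A _ _).hom

/-- The `(m-1)`-fold product
`prod ∘ (id ⊗ prod) ∘ ⋯ ∘ (id ⊗ ⋯ ⊗ id ⊗ prod)` from `A^{⊗ m}` to `A`;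
for `m = 1` it is the identity, for `m = 0` it is `prod ∘ cap` in place of a unit. -/
def iteratedProd (S : SpiderOperations A) : (m : ℕ) → (tensorPow A m ⟶ A)
  | 0 => S.cap ≫ S.prod
  | 1 => (tensorPowOne A).hom
  | m + 2 => (α_ (tensorPow A m) A A).hom ≫ tensorPow A m ◁ S.prod ≫ S.iteratedProd (m + 1)

/-- The `(n-1)`-fold coproduct
`(id ⊗ ⋯ ⊗ id ⊗ coprod) ∘ ⋯ ∘ (id ⊗ coprod) ∘ coprod` from `A` to `A^{⊗ n}`;
for `n = 1` it is the identity, for `n = 0` it is `cup ∘ coprod` in place of a counit. -/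
def iteratedCoprod (S : SpiderOperations A) : (n : ℕ) → (A ⟶ tensorPow A n)
  | 0 => S.coprod ≫ S.cup
  | 1 => (tensorPowOne A).inv
  | n + 2 => S.iteratedCoprod (n + 1) ≫ tensorPow A n ◁ S.coprod ≫ (α_ (tensorPow A n) A A).inv

/-- The standard form with `m` legs in and `n` legs out. -/
def standardForm (S : SpiderOperations A) (m n : ℕ) : tensorPow A m ⟶ tensorPow A n :=
  S.iteratedProd m ≫ S.iteratedCoprod n

/-- The planar spider property: every connected planar diagram equals the standard form. -/
def IsPlanarSpider (S : SpiderOperations A) : Prop :=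
  ∀ (m n : ℕ) (d : PlanarDiagram m n), d.IsConnected → S.eval d = S.standardForm m n

end SpiderOperations

/-! In a special Frobenius algebra the cup is a product followed by a counit and the cap is a unit
followed by a coproduct. A diagram can therefore be cut into layers holding one product, coproduct,
unit or counit each.

A product below a coproduct or a unit can be moved up: speciality and the unit laws absorb it, and
the Frobenius relations and the interchange law let it pass (`push_mul_layer`). A counit also passes
or is absorbed, unless it meets a unit or arrives directly below the products; either case leaves a
component that does not reach the bottom (`push_counit`). If every component reaches the bottom,
only products followed by coproducts and units remain (`exists_sim_append`). Distinct strands at the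
waist between the two parts lie in distinct components, so a connected diagram has a waist of at
most one strand, and a unit occurs only at the top of an empty waist. Associativity and
coassociativity then give the standard form. A diagram with no leg out is reduced to this case by
splitting a leg in and closing the copy by a counit at the end.

Connectedness is tracked by colorings of the strands with two colors, constant on components. The
rewriting moves preserve the morphism and also the relation between the colorings above and below
(`Sim`).

Conversely, each Frobenius axiom compares connected diagrams with the same legs, as do the formulas
for the cup and the cap. Speciality makes the two constructions inverse, since `prod ∘ cap` is then
the unit and `cup ∘ coprod` the counit. -/

/-! ### Layers, words and their colorings -/

/-- An elementary layer of a planar diagram: one operation, with strands to its left and right.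
The layers `mul a`, `comul a`, `one a` and `counit a` have `a` strands to the left of the operation,
and `whisker` adds a strand at the right. -/
inductive Layer : ℕ → ℕ → Type
  | mul (a : ℕ) : Layer (a + 2) (a + 1)
  | comul (a : ℕ) : Layer (a + 1) (a + 2)
  | one (a : ℕ) : Layer a (a + 1)
  | counit (a : ℕ) : Layer (a + 1) a
  | whisker {m n : ℕ} (l : Layer m n) : Layer (m + 1) (n + 1)

/-- A sequence of layers, read from top to bottom. -/
inductive Word (m : ℕ) : ℕ → Type
  | nil : Word m m
  | snoc {k n : ℕ} (w : Word m k) (l : Layer k n) : Word m n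

/-- The colorings of `n` strands by two colors. -/
abbrev Col : ℕ → Type
  | 0 => Unit
  | n + 1 => Col n × Bool

namespace Layer

/-- The compatibility of a coloring of the strands above a layer with one of those below it:
colors are constant on connected components. -/
def Rel {m n : ℕ} : Layer m n → Col m → Col n → Prop
  | mul _ => fun x z => x.1 = z ∧ x.2 = z.2
  | comul _ => fun x z => z.1 = x ∧ z.2 = x.2
  | one _ => fun x z => z.1 = x
  | counit _ => fun x z => x.1 = z
  | whisker l => fun x z => l.Rel x.1 z.1 ∧ x.2 = z.2

/-- The layer with `a` more strands at the left. -/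
def whiskerLeft (a : ℕ) {m n : ℕ} : Layer m n → Layer (a + m) (a + n)
  | mul k => mul (a + k)
  | comul k => comul (a + k)
  | one k => one (a + k)
  | counit k => counit (a + k)
  | whisker l => whisker (l.whiskerLeft a)

/-- The operation of the layer is a product. -/
def IsMul {m n : ℕ} : Layer m n → Prop
  | mul _ => True
  | whisker l => l.IsMul
  | _ => False

/-- The operation of the layer is a counit. -/
def IsCounit {m n : ℕ} : Layer m n → Prop
  | counit _ => True
  | whisker l => l.IsCounit
  | _ => False

/-- The operation of the layer is a coproduct. -/
def IsComul {m n : ℕ} : Layer m n → Prop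
  | comul _ => True
  | whisker l => l.IsComul
  | _ => False

/-- The operation of the layer is a unit. -/
def IsOne {m n : ℕ} : Layer m n → Prop
  | one _ => True
  | whisker l => l.IsOne
  | _ => False

/-- The operation of the layer is a coproduct or a unit. -/
def IsExpansion {m n : ℕ} (l : Layer m n) : Prop := l.IsComul ∨ l.IsOne

end Layer

namespace Word

/-- The concatenation of two words. -/
def append {m k n : ℕ} (w : Word m k) : Word k n → Word m n
  | nil => w
  | snoc v l => snoc (w.append v) l

/-- The word consisting of one layer. -/
abbrev single {m n : ℕ} (l : Layer m n) : Word m n := snoc nil l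

/-- The word with one more strand at the right. -/
def whisker {m n : ℕ} : Word m n → Word (m + 1) (n + 1)
  | nil => nil
  | snoc w l => snoc w.whisker l.whisker

/-- The word with `b` more strands at the right. -/
def whiskerRight {m n : ℕ} (w : Word m n) : (b : ℕ) → Word (m + b) (n + b)
  | 0 => w
  | b + 1 => (w.whiskerRight b).whisker

/-- The word with `a` more strands at the left. -/
def whiskerLeft (a : ℕ) {m n : ℕ} : Word m n → Word (a + m) (a + n)
  | nil => nil
  | snoc w l => snoc (w.whiskerLeft a) (l.whiskerLeft a)

/-- The compatibility of colorings of the strands above and below a word. -/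
def Rel {m n : ℕ} : Word m n → Col m → Col n → Prop
  | nil => fun x z => x = z
  | snoc w l => fun x z => ∃ y, w.Rel x y ∧ l.Rel y z

/-- All layers of the word satisfy a property. -/
def All (P : ∀ {m n : ℕ}, Layer m n → Prop) {m n : ℕ} : Word m n → Prop
  | nil => True
  | snoc w l => w.All P ∧ P l

@[simp]
theorem append_assoc {m k j n : ℕ} (u : Word m k) (v : Word k j) (w : Word j n) :
    (u.append v).append w = u.append (v.append w) := by
  induction w with
  | nil => rfl
  | snoc w l ih => simp [append, ih]

@[simp]
theorem nil_append {m n : ℕ} (w : Word m n) : (nil : Word m m).append w = w := by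
  induction w with
  | nil => rfl
  | snoc w l ih => simp [append, ih]

theorem whisker_append {m k n : ℕ} (u : Word m k) (v : Word k n) :
    (u.append v).whisker = u.whisker.append v.whisker := by
  induction v with
  | nil => rfl
  | snoc v l ih => simp [append, whisker, ih]

theorem rel_append {m k n : ℕ} (u : Word m k) (v : Word k n) (x : Col m) (z : Col n) :
    (u.append v).Rel x z ↔ ∃ y, u.Rel x y ∧ v.Rel y z := by
  induction v with
  | nil => simp [append, Rel]
  | snoc v l ih =>
    simp only [append, Rel, ih]
    constructor
    · rintro ⟨y, ⟨y', h, h'⟩, h''⟩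
      exact ⟨y', h, y, h', h''⟩
    · rintro ⟨y', h, y, h', h''⟩
      exact ⟨y, ⟨y', h, h'⟩, h''⟩

theorem rel_whisker {m n : ℕ} (w : Word m n) (x : Col (m + 1)) (z : Col (n + 1)) :
    w.whisker.Rel x z ↔ w.Rel x.1 z.1 ∧ x.2 = z.2 := by
  induction w with
  | nil => exact Prod.ext_iff
  | snoc w l ih =>
    simp only [whisker, Rel, ih, Layer.Rel]
    constructor
    · rintro ⟨y, ⟨h, h'⟩, h'', h'''⟩
      exact ⟨⟨y.1, h, h''⟩, h'.trans h'''⟩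
    · rintro ⟨⟨y, h, h'⟩, h''⟩
      exact ⟨(y, x.2), ⟨h, rfl⟩, h', h''⟩

theorem All.append {P : ∀ {m n : ℕ}, Layer m n → Prop} {m k n : ℕ} {u : Word m k} {v : Word k n}
    (hu : u.All P) (hv : v.All P) : (u.append v).All P := by
  induction v with
  | nil => exact hu
  | snoc v l ih => exact ⟨ih hv.1, hv.2⟩

theorem All.whisker {P : ∀ {m n : ℕ}, Layer m n → Prop}
    (hP : ∀ {m n : ℕ} (l : Layer m n), P l → P l.whisker) {m n : ℕ} {u : Word m n}
    (hu : u.All P) : u.whisker.All P := by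
  induction u with
  | nil => trivial
  | snoc u l ih => exact ⟨ih hu.1, hP _ hu.2⟩

end Word

/-! ### Evaluation of words and the rewriting moves -/

namespace SpiderOperations

variable {C : Type u} [Category.{v} C] [MonoidalCategory C] {A : C} (S : SpiderOperations A)

/-- The unit `prod ∘ cap`. -/
def unit : 𝟙_ C ⟶ A := S.cap ≫ S.prod

/-- The counit `cup ∘ coprod`. -/
def counit : A ⟶ 𝟙_ C := S.coprod ≫ S.cup

/-- The operations are those of a special Frobenius algebra with unit `prod ∘ cap` and counit
`cup ∘ coprod`. -/
structure IsSpecialFrobenius : Prop where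
  unit_prod : S.unit ▷ A ≫ S.prod = (λ_ A).hom
  prod_unit : A ◁ S.unit ≫ S.prod = (ρ_ A).hom
  prod_assoc : S.prod ▷ A ≫ S.prod = (α_ A A A).hom ≫ A ◁ S.prod ≫ S.prod
  coprod_counit_left : S.coprod ≫ S.counit ▷ A = (λ_ A).inv
  coprod_counit_right : S.coprod ≫ A ◁ S.counit = (ρ_ A).inv
  coprod_assoc : S.coprod ≫ A ◁ S.coprod = S.coprod ≫ S.coprod ▷ A ≫ (α_ A A A).hom
  frobenius_left : A ◁ S.coprod ≫ (α_ A A A).inv ≫ S.prod ▷ A = S.prod ≫ S.coprod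
  frobenius_right : S.coprod ▷ A ≫ (α_ A A A).hom ≫ A ◁ S.prod = S.prod ≫ S.coprod
  special : S.coprod ≫ S.prod = 𝟙 A
  cup_eq : S.cup = S.prod ≫ S.counit
  cap_eq : S.cap = S.unit ≫ S.coprod

/-- The morphism represented by a layer. -/
def evalLayer (S : SpiderOperations A) {m n : ℕ} : Layer m n → (tensorPow A m ⟶ tensorPow A n)
  | .mul a => (α_ (tensorPow A a) A A).hom ≫ tensorPow A a ◁ S.prod
  | .comul a => tensorPow A a ◁ S.coprod ≫ (α_ (tensorPow A a) A A).inv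
  | .one a => (ρ_ (tensorPow A a)).inv ≫ tensorPow A a ◁ S.unit
  | .counit a => tensorPow A a ◁ S.counit ≫ (ρ_ (tensorPow A a)).hom
  | .whisker l => S.evalLayer l ▷ A

/-- The morphism represented by a word. -/
def evalWord (S : SpiderOperations A) {m n : ℕ} : Word m n → (tensorPow A m ⟶ tensorPow A n)
  | .nil => 𝟙 (tensorPow A m)
  | .snoc w l => S.evalWord w ≫ S.evalLayer l

theorem evalWord_append {m k n : ℕ} (u : Word m k) (v : Word k n) :
    S.evalWord (u.append v) = S.evalWord u ≫ S.evalWord v := by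
  induction v with
  | nil => simp [Word.append, evalWord]
  | snoc v l ih => simp [Word.append, evalWord, ih]

theorem evalWord_whisker {m n : ℕ} (w : Word m n) :
    S.evalWord w.whisker = S.evalWord w ▷ A := by
  induction w with
  | nil => simp [Word.whisker, evalWord]
  | snoc w l ih => simp [Word.whisker, evalWord, evalLayer, ih]

/-- Two words represent the same morphism and impose the same relation on colorings. -/
def Sim {m n : ℕ} (u v : Word m n) : Prop :=
  S.evalWord u = S.evalWord v ∧ ∀ x z, u.Rel x z ↔ v.Rel x z

variable {S}

theorem Sim.refl {m n : ℕ} (u : Word m n) : S.Sim u u := ⟨rfl, fun _ _ => Iff.rfl⟩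

theorem Sim.trans {m n : ℕ} {u v w : Word m n} (h : S.Sim u v) (h' : S.Sim v w) : S.Sim u w :=
  ⟨h.1.trans h'.1, fun x z => (h.2 x z).trans (h'.2 x z)⟩

theorem Sim.append {m k n : ℕ} {u u' : Word m k} {v v' : Word k n} (h : S.Sim u u')
    (h' : S.Sim v v') : S.Sim (u.append v) (u'.append v') :=
  ⟨by rw [evalWord_append, evalWord_append, h.1, h'.1],
    fun x z => by simp only [Word.rel_append, h.2, h'.2]⟩

theorem Sim.whisker {m n : ℕ} {u v : Word m n} (h : S.Sim u v) : S.Sim u.whisker v.whisker :=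
  ⟨by rw [evalWord_whisker, evalWord_whisker, h.1],
    fun x z => by simp only [Word.rel_whisker, h.2]⟩

open Word

section Relations

/-- The interchange law: the two operations act on disjoint strands. The same reason gives the three
lemmas that follow. -/
theorem sim_mul_whisker {m n : ℕ} (l : Layer m n) :
    S.Sim ((single l.whisker.whisker).snoc (.mul n)) ((single (.mul m)).snoc l.whisker) := by
  constructor
  · simp only [evalWord, evalLayer, Category.id_comp, Category.assoc]
    rw [associator_naturality_left_assoc, whisker_exchange]
  · simp [Word.Rel, Layer.Rel]

theorem sim_comul_whisker {m n : ℕ} (l : Layer m n) :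
    S.Sim ((single (.comul m)).snoc l.whisker.whisker) ((single l.whisker).snoc (.comul n)) := by
  constructor
  · simp only [evalWord, evalLayer, Category.id_comp, Category.assoc]
    rw [← associator_inv_naturality_left, whisker_exchange_assoc]
  · simp [Word.Rel, Layer.Rel]

theorem sim_one_whisker {m n : ℕ} (l : Layer m n) :
    S.Sim ((single (.one m)).snoc l.whisker) ((single l).snoc (.one n)) := by
  constructor
  · simp only [evalWord, evalLayer, Category.id_comp, Category.assoc]
    rw [whisker_exchange, rightUnitor_inv_naturality_assoc]
  · simp [Word.Rel, Layer.Rel]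

theorem sim_counit_whisker {m n : ℕ} (l : Layer m n) :
    S.Sim ((single l.whisker).snoc (.counit n)) ((single (.counit m)).snoc l) := by
  constructor
  · simp only [evalWord, evalLayer, Category.id_comp, Category.assoc]
    rw [← rightUnitor_naturality, whisker_exchange_assoc]
  · simp [Word.Rel, Layer.Rel]

variable (hS : S.IsSpecialFrobenius) (a : ℕ)
include hS

/-- Associativity serves only after the normal form is reached, when colorings are no longer
tracked; an equality of morphisms suffices. The same holds for coassociativity below. -/
theorem evalLayer_mul_assoc :
    S.evalLayer (Layer.mul a).whisker ≫ S.evalLayer (.mul a) =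
      S.evalLayer (.mul (a + 1)) ≫ S.evalLayer (.mul a) := by
  have h := hS.prod_assoc
  simp only [evalLayer, tensorPow]
  generalize tensorPow A a = X
  calc _ = (α_ X A A).hom ▷ A ≫ (α_ _ _ _).hom ≫ X ◁ (S.prod ▷ A ≫ S.prod) := by simp
    _ = _ := by
      rw [h]
      simp

theorem evalLayer_comul_assoc :
    S.evalLayer (Layer.comul a) ≫ S.evalLayer (Layer.comul a).whisker =
      S.evalLayer (Layer.comul a) ≫ S.evalLayer (.comul (a + 1)) := by
  have h := hS.coprod_assoc
  simp only [evalLayer, tensorPow]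
  generalize tensorPow A a = X
  have h' : S.coprod ≫ S.coprod ▷ A = S.coprod ≫ A ◁ S.coprod ≫ (α_ A A A).inv := by
    rw [reassoc_of% h]
    simp
  calc _ = X ◁ (S.coprod ≫ S.coprod ▷ A) ≫ (α_ _ _ _).inv ≫ (α_ X A A).inv ▷ A := by simp
    _ = _ := by
      rw [h']
      simp

theorem sim_one_whisker_mul :
    S.Sim ((single (Layer.one a).whisker).snoc (.mul a)) nil := by
  constructor
  · have h := hS.unit_prod
    simp only [evalWord, evalLayer, tensorPow]
    generalize tensorPow A a = X
    calc _ = (ρ_ X).inv ▷ A ≫ (α_ _ _ _).hom ≫ X ◁ (S.unit ▷ A ≫ S.prod) := by simp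
      _ = _ := by
        rw [h]
        simp
  · simp [Word.Rel, Layer.Rel]
    grind

theorem sim_one_mul :
    S.Sim ((single (Layer.one (a + 1))).snoc (.mul a)) nil := by
  constructor
  · have h := hS.prod_unit
    simp only [evalWord, evalLayer, tensorPow]
    generalize tensorPow A a = X
    calc _ = X ◁ (ρ_ A).inv ≫ X ◁ (A ◁ S.unit ≫ S.prod) := by simp
      _ = _ := by
        rw [h]
        simp
  · simp [Word.Rel, Layer.Rel]

theorem sim_comul_counit_whisker :
    S.Sim ((single (Layer.comul a)).snoc (Layer.counit a).whisker) nil := by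
  constructor
  · have h := hS.coprod_counit_left
    simp only [evalWord, evalLayer, tensorPow]
    generalize tensorPow A a = X
    calc _ = X ◁ (S.coprod ≫ S.counit ▷ A) ≫ (α_ _ _ _).inv ≫ (ρ_ X).hom ▷ A := by simp
      _ = _ := by
        rw [h]
        simp
  · simp [Word.Rel, Layer.Rel]
    grind

theorem sim_comul_counit :
    S.Sim ((single (Layer.comul a)).snoc (Layer.counit (a + 1))) nil := by
  constructor
  · have h := hS.coprod_counit_right
    simp only [evalWord, evalLayer, tensorPow]
    generalize tensorPow A a = X
    calc _ = X ◁ (S.coprod ≫ A ◁ S.counit) ≫ X ◁ (ρ_ A).hom := by simp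
      _ = _ := by
        rw [h]
        simp
  · simp [Word.Rel, Layer.Rel]

theorem sim_comul_mul :
    S.Sim ((single (Layer.comul a)).snoc (Layer.mul a)) nil := by
  constructor
  · have h := hS.special
    simp only [evalWord, evalLayer, tensorPow]
    generalize tensorPow A a = X
    calc _ = X ◁ (S.coprod ≫ S.prod) := by simp
      _ = _ := by
        rw [h]
        simp
  · simp [Word.Rel, Layer.Rel]
    grind

theorem sim_comul_whisker_mul :
    S.Sim ((single (Layer.comul a).whisker).snoc (.mul (a + 1)))
      ((single (.mul a)).snoc (.comul a)) := by
  constructor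
  · have h := hS.frobenius_right
    simp only [evalWord, evalLayer, tensorPow]
    generalize tensorPow A a = X
    calc _ = (α_ X A A).hom ≫ X ◁ (S.coprod ▷ A ≫ (α_ A A A).hom ≫ A ◁ S.prod) ≫
        (α_ _ _ _).inv := by simp
      _ = _ := by
        rw [h]
        simp
  · simp [Word.Rel, Layer.Rel]
    grind

theorem sim_comul_mul_whisker :
    S.Sim ((single (Layer.comul (a + 1))).snoc (Layer.mul a).whisker)
      ((single (.mul a)).snoc (.comul a)) := by
  constructor
  · have h := hS.frobenius_left
    simp only [evalWord, evalLayer, tensorPow]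
    generalize tensorPow A a = X
    calc _ = (α_ X A A).hom ≫ X ◁ (A ◁ S.coprod ≫ (α_ A A A).inv ≫ S.prod ▷ A) ≫
        (α_ _ _ _).inv := by simp
      _ = _ := by
        rw [h]
        simp
  · simp [Word.Rel, Layer.Rel]
    grind

end Relations
end SpiderOperations

/-! ### Extension of colorings through layers -/

/-- The coloring of all strands by the same color. -/
def Col.const (b : Bool) : (n : ℕ) → Col n
  | 0 => ()
  | n + 1 => (const b n, b)

namespace Layer

theorem rel_const (b : Bool) {m n : ℕ} (l : Layer m n) : l.Rel (Col.const b m) (Col.const b n) := by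
  induction l with
  | whisker l ih => exact ⟨ih, rfl⟩
  | _ => simp [Rel, Col.const]

theorem isMul_or_isCounit_or_isExpansion {m n : ℕ} (l : Layer m n) :
    l.IsMul ∨ l.IsCounit ∨ l.IsExpansion := by
  unfold IsExpansion
  induction l with
  | whisker l ih => exact ih
  | _ => simp [IsMul, IsCounit, IsComul, IsOne]

theorem IsMul.exists_rel {m n : ℕ} {l : Layer m n} (h : l.IsMul) (z : Col n) :
    ∃ y, l.Rel y z := by
  induction l with
  | mul a => exact ⟨(z, z.2), rfl, rfl⟩
  | whisker l ih =>
    obtain ⟨y, hy⟩ := ih h z.1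
    exact ⟨(y, z.2), hy, rfl⟩
  | _ => exact h.elim

theorem IsExpansion.exists_rel {m n : ℕ} {l : Layer m n} (h : l.IsExpansion) (y : Col m) :
    ∃ z, l.Rel y z := by
  induction l with
  | comul a => exact ⟨(y, y.2), rfl, rfl⟩
  | one a => exact ⟨(y, true), rfl⟩
  | whisker l ih =>
    obtain ⟨z, hz⟩ := ih h y.1
    exact ⟨(z, y.2), hz, rfl⟩
  | _ => exact (or_self_iff.1 h).elim

/-- A coproduct or a unit ends no component, so every color above survives below. -/
theorem IsExpansion.eq_const {m n : ℕ} {l : Layer m n} (h : l.IsExpansion) {b : Bool} {y : Col m}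
    (hy : l.Rel y (Col.const b n)) : y = Col.const b m := by
  induction l with
  | comul a => exact hy.1.symm
  | one a => exact hy.symm
  | whisker l ih => exact Prod.ext (ih h hy.1) hy.2
  | _ => exact (or_self_iff.1 h).elim

/-- The strand closed by the counit is not seen below, so its color is free. -/
theorem IsCounit.exists_rel_const {m n : ℕ} {l : Layer m n} (h : l.IsCounit) :
    ∃ y, y ≠ Col.const false m ∧ l.Rel y (Col.const false n) := by
  induction l with
  | counit a => exact ⟨(Col.const false a, true), by simp [Col.const], rfl⟩
  | whisker l ih =>
    obtain ⟨y, hy, hy'⟩ := ih h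
    exact ⟨(y, false), fun h => hy (congrArg Prod.fst h), hy', rfl⟩
  | _ => exact h.elim

theorem IsOne.exists_rel_const {m n : ℕ} {l : Layer m n} (h : l.IsOne) :
    ∃ z, z ≠ Col.const false n ∧ l.Rel (Col.const false m) z := by
  induction l with
  | one a => exact ⟨(Col.const false a, true), by simp [Col.const], rfl⟩
  | whisker l ih =>
    obtain ⟨y, hy, hy'⟩ := ih h
    exact ⟨(y, false), fun h => hy (congrArg Prod.fst h), hy', rfl⟩
  | _ => exact h.elim

end Layer

namespace Word

theorem rel_const (b : Bool) {m n : ℕ} (w : Word m n) : w.Rel (Col.const b m) (Col.const b n) := by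
  induction w with
  | nil => rfl
  | snoc w l ih => exact ⟨_, ih, l.rel_const b⟩

theorem exists_rel_of_isMul {m n : ℕ} {w : Word m n} (h : w.All Layer.IsMul) (z : Col n) :
    ∃ y, w.Rel y z := by
  induction w with
  | nil => exact ⟨z, rfl⟩
  | snoc w l ih =>
    obtain ⟨y, hy⟩ := h.2.exists_rel z
    obtain ⟨x, hx⟩ := ih h.1 y
    exact ⟨x, y, hx, hy⟩

theorem exists_rel_of_isExpansion {m n : ℕ} {w : Word m n} (h : w.All Layer.IsExpansion)
    (x : Col m) : ∃ z, w.Rel x z := by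
  induction w with
  | nil => exact ⟨x, rfl⟩
  | snoc w l ih =>
    obtain ⟨y, hy⟩ := ih h.1
    obtain ⟨z, hz⟩ := h.2.exists_rel y
    exact ⟨z, y, hy, hz⟩

theorem eq_const_of_isExpansion {m n : ℕ} {w : Word m n} (h : w.All Layer.IsExpansion)
    {b : Bool} {x : Col m} (hx : w.Rel x (Col.const b n)) : x = Col.const b m := by
  induction w with
  | nil => exact hx
  | snoc w l ih =>
    obtain ⟨y, hy, hz⟩ := hx
    exact ih h.1 (h.2.eq_const hz ▸ hy)

/-- In each initial segment of the word, every connected component reaches the bottom. -/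
def ReachesBottom {m n : ℕ} : Word m n → Prop
  | nil => True
  | snoc w l => w.ReachesBottom ∧
      ∀ x y, w.Rel x y → l.Rel y (Col.const false _) → y = Col.const false _

end Word

/-! ### Normal form: products, then coproducts and units -/

namespace SpiderOperations

variable {C : Type u} [Category.{v} C] [MonoidalCategory C] {A : C} {S : SpiderOperations A}

open Word Layer

/-- Speciality and the unit laws give the first alternative. The Frobenius relations and interchange
give the second; it yields a single product again, which keeps the later induction on the word
simple. -/
theorem IsSpecialFrobenius.push_mul_layer (hS : S.IsSpecialFrobenius) :
    ∀ {k n n' : ℕ} (l : Layer k n) (g : Layer n n'), l.IsExpansion → g.IsMul →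
      (∃ W : Word k n', W.All Layer.IsExpansion ∧ S.Sim ((single l).snoc g) W) ∨
      ∃ (q : ℕ) (g' : Layer k q) (W : Word q n'), g'.IsMul ∧ W.All Layer.IsExpansion ∧
        S.Sim ((single l).snoc g) ((single g').append W)
  | _, _, _, .comul a, .mul _, _, _ => .inl ⟨nil, trivial, sim_comul_mul hS a⟩
  | _, _, _, .comul _, .whisker (.mul b), _, _ =>
    .inr ⟨_, .mul b, single (.comul b), trivial, ⟨trivial, .inl trivial⟩,
      sim_comul_mul_whisker hS b⟩
  | _, _, _, .comul _, .whisker (.whisker g), _, hg =>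
    .inr ⟨_, g.whisker, single (.comul _), hg, ⟨trivial, .inl trivial⟩, sim_comul_whisker g⟩
  | _, _, _, .comul _, .whisker (.counit _), _, hg => hg.elim
  | _, _, _, .one _, .mul b, _, _ => .inl ⟨nil, trivial, sim_one_mul hS b⟩
  | _, _, _, .one _, .whisker g, _, hg =>
    .inr ⟨_, g, single (.one _), hg, ⟨trivial, .inr trivial⟩, sim_one_whisker g⟩
  | _, _, _, .whisker (.comul _), .mul _, _, _ =>
    .inr ⟨_, .mul _, single (.comul _), trivial, ⟨trivial, .inl trivial⟩,
      sim_comul_whisker_mul hS _⟩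
  | _, _, _, .whisker (.one _), .mul _, _, _ => .inl ⟨nil, trivial, sim_one_whisker_mul hS _⟩
  | _, _, _, .whisker (.whisker l), .mul _, hl, _ =>
    .inr ⟨_, .mul _, single l.whisker, trivial, ⟨trivial, hl⟩, sim_mul_whisker l⟩
  | _, _, _, .whisker l, .whisker g, hl, hg => by
    obtain ⟨W, hW, h⟩ | ⟨q, g', W, hg', hW, h⟩ := hS.push_mul_layer l g hl hg
    · exact .inl ⟨W.whisker, hW.whisker fun _ h => h, h.whisker⟩
    · refine .inr ⟨_, g'.whisker, W.whisker, hg', hW.whisker fun _ h => h, ?_⟩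
      exact (whisker_append (single g') W) ▸ h.whisker

/-- The third alternative is a unit directly closed by the counit: no axiom removes it, but it is a
component cut off from both sides, whose color can be chosen freely. -/
theorem IsSpecialFrobenius.push_counit_layer (hS : S.IsSpecialFrobenius) :
    ∀ {k n n' : ℕ} (l : Layer k n) (g : Layer n n'), l.IsExpansion → g.IsCounit →
      (∃ W : Word k n', W.All Layer.IsExpansion ∧ S.Sim ((single l).snoc g) W) ∨
      (∃ (q : ℕ) (g' : Layer k q) (W : Word q n'), g'.IsCounit ∧ W.All Layer.IsExpansion ∧
        S.Sim ((single l).snoc g) ((single g').append W)) ∨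
      ∃ y, y ≠ Col.const false n ∧ l.Rel (Col.const false k) y ∧ g.Rel y (Col.const false n')
  | _, _, _, .comul a, .counit _, _, _ => .inl ⟨nil, trivial, sim_comul_counit hS a⟩
  | _, _, _, .comul _, .whisker (.counit b), _, _ =>
    .inl ⟨nil, trivial, sim_comul_counit_whisker hS b⟩
  | _, _, _, .comul _, .whisker (.whisker g), _, hg =>
    .inr (.inl ⟨_, g.whisker, single (.comul _), hg, ⟨trivial, .inl trivial⟩,
      sim_comul_whisker g⟩)
  | _, _, _, .one _, .counit b, _, _ =>
    .inr (.inr ⟨(Col.const false _, true), by simp [Col.const], rfl, rfl⟩)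
  | _, _, _, .one _, .whisker g, _, hg =>
    .inr (.inl ⟨_, g, single (.one _), hg, ⟨trivial, .inr trivial⟩, sim_one_whisker g⟩)
  | _, _, _, .whisker l, .counit _, hl, _ =>
    .inr (.inl ⟨_, .counit _, single l, trivial, ⟨trivial, hl⟩, sim_counit_whisker l⟩)
  | _, _, _, .whisker l, .whisker g, hl, hg => by
    obtain ⟨W, hW, h⟩ | ⟨q, g', W, hg', hW, h⟩ | ⟨y, hy, h, h'⟩ :=
      hS.push_counit_layer l g hl hg
    · exact .inl ⟨W.whisker, hW.whisker fun _ h => h, h.whisker⟩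
    · refine .inr (.inl ⟨_, g'.whisker, W.whisker, hg', hW.whisker fun _ h => h, ?_⟩)
      exact (whisker_append (single g') W) ▸ h.whisker
    · exact .inr (.inr ⟨(y, false), fun h => hy (congrArg Prod.fst h), ⟨h, rfl⟩, h', rfl⟩)

theorem IsSpecialFrobenius.push_mul (hS : S.IsSpecialFrobenius) {k n n' : ℕ} (W : Word k n)
    (g : Layer n n') (hW : W.All Layer.IsExpansion) (hg : g.IsMul) :
    ∃ (q : ℕ) (M : Word k q) (W' : Word q n'), M.All Layer.IsMul ∧ W'.All Layer.IsExpansion ∧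
      S.Sim (W.snoc g) (M.append W') := by
  induction W generalizing n' with
  | nil => exact ⟨_, single g, nil, ⟨trivial, hg⟩, trivial, Sim.refl _⟩
  | snoc W l ih =>
    obtain ⟨V, hV, h⟩ | ⟨q, g', V, hg', hV, h⟩ := hS.push_mul_layer l g hW.2 hg
    · exact ⟨_, nil, W.append V, trivial, hW.1.append hV,
        (nil_append (W.append V)).symm ▸ (Sim.refl W).append h⟩
    · obtain ⟨q, M, W', hM, hW', h'⟩ := ih g' hW.1 hg'
      refine ⟨q, M, W'.append V, hM, hW'.append hV, ((Sim.refl W).append h).trans ?_⟩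
      rw [← append_assoc, ← append_assoc]
      exact h'.append (Sim.refl V)

theorem IsSpecialFrobenius.push_counit (hS : S.IsSpecialFrobenius) {k n n' : ℕ} (W : Word k n)
    (g : Layer n n') (hW : W.All Layer.IsExpansion) (hg : g.IsCounit)
    (hWg : ∀ x y, W.Rel x y → g.Rel y (Col.const false _) → y = Col.const false _) :
    ∃ W' : Word k n', W'.All Layer.IsExpansion ∧ S.Sim (W.snoc g) W' := by
  induction W generalizing n' with
  | nil =>
    obtain ⟨y, hy, hy'⟩ := hg.exists_rel_const
    -- At the top of the expansions the counit closes a strand whose free color contradicts `hWg`.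
    exact absurd (hWg y y rfl hy') hy
  | snoc W l ih =>
    obtain ⟨V, hV, h⟩ | ⟨q, g', V, hg', hV, h⟩ | ⟨y, hy, h, h'⟩ :=
      hS.push_counit_layer l g hW.2 hg
    · exact ⟨W.append V, hW.1.append hV, (Sim.refl W).append h⟩
    -- The coloring condition passes to the moved counit: extend by the constant coloring through
    -- `V`, carry the result over to `l` and `g` by `Sim`, and return through the expansion `l`.
    · obtain ⟨W', hW', h'⟩ := ih g' hW.1 hg' fun x y hx hy => by
        obtain ⟨y', ⟨_, rfl, h₁⟩, h₂⟩ := (h.2 y _).2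
          ((rel_append _ _ _ _).2 ⟨_, ⟨_, rfl, hy⟩, V.rel_const false⟩)
        exact hW.2.eq_const (hWg x y' ⟨y, hx, h₁⟩ h₂ ▸ h₁)
      refine ⟨W'.append V, hW'.append hV, ((Sim.refl W).append h).trans ?_⟩
      rw [← append_assoc]
      exact h'.append (Sim.refl V)
    · exact absurd (hWg _ y ⟨_, W.rel_const false, h⟩ h') hy

/-- A word all of whose components reach the bottom is a product of products, followed by
coproducts and units. -/
theorem IsSpecialFrobenius.exists_sim_append (hS : S.IsSpecialFrobenius) {m n : ℕ} (w : Word m n)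
    (hw : w.ReachesBottom) :
    ∃ (p : ℕ) (M : Word m p) (W : Word p n), M.All Layer.IsMul ∧ W.All Layer.IsExpansion ∧
      S.Sim w (M.append W) := by
  induction w with
  | nil => exact ⟨_, nil, nil, trivial, trivial, Sim.refl _⟩
  | snoc w l ih =>
    obtain ⟨p, M, W, hM, hW, h⟩ := ih hw.1
    have h₁ : S.Sim (w.snoc l) (M.append (W.snoc l)) := h.append (Sim.refl (single l))
    obtain hl | hl | hl := l.isMul_or_isCounit_or_isExpansion
    · obtain ⟨q, M', W', hM', hW', h'⟩ := hS.push_mul W l hW hl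
      refine ⟨q, M.append M', W', hM.append hM', hW', h₁.trans ?_⟩
      rw [append_assoc]
      exact (Sim.refl M).append h'
    · obtain ⟨W', hW', h'⟩ := hS.push_counit W l hW hl fun x y hx hy => by
        -- Products impose no condition on the colors below them, so a coloring of `W` extends to
        -- all of `w`.
        obtain ⟨x', hx'⟩ := exists_rel_of_isMul hM x
        exact hw.2 x' y ((h.2 _ _).2 ((rel_append _ _ _ _).2 ⟨x, hx', hx⟩)) hy
      exact ⟨p, M, W', hM, hW', h₁.trans ((Sim.refl M).append h')⟩
    · exact ⟨p, M, W.snoc l, hM, ⟨hW, hl⟩, h₁⟩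

/-- A product of the last two strands is absorbed by definition and one a strand further left by
associativity. Any other commutes with the last product, which leaves one strand fewer. -/
theorem IsSpecialFrobenius.evalLayer_comp_iteratedProd (hS : S.IsSpecialFrobenius) :
    ∀ {m n : ℕ} (l : Layer m n), l.IsMul →
      S.evalLayer l ≫ S.iteratedProd n = S.iteratedProd m
  | _, _, .mul _, _ => by simp [evalLayer, iteratedProd]
  | _, _, .whisker (.one _), hl => hl.elim
  | _, _, .whisker (.counit _), hl => hl.elim
  | _, _, .whisker (.mul a), _ => by
    have h := evalLayer_mul_assoc hS a
    have h' : ∀ a, S.iteratedProd (a + 2) = S.evalLayer (.mul a) ≫ S.iteratedProd (a + 1) :=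
      fun a => by simp [evalLayer, iteratedProd]
    rw [h', reassoc_of% h, ← h', ← h']
  | _, _, .whisker (.whisker (m := m) (n := n) l), hl => by
    have h := (sim_mul_whisker (S := S) l).1
    have h' : ∀ a, S.iteratedProd (a + 2) = S.evalLayer (.mul a) ≫ S.iteratedProd (a + 1) :=
      fun a => by simp [evalLayer, iteratedProd]
    simp only [evalWord, Category.id_comp] at h
    rw [h', reassoc_of% h, hS.evalLayer_comp_iteratedProd l.whisker hl, ← h']

theorem IsSpecialFrobenius.iteratedCoprod_comp_evalLayer (hS : S.IsSpecialFrobenius) :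
    ∀ {m n : ℕ} (l : Layer m n), l.IsComul →
      S.iteratedCoprod m ≫ S.evalLayer l = S.iteratedCoprod n
  | _, _, .comul _, _ => by simp [evalLayer, iteratedCoprod]
  | _, _, .whisker (.one _), hl => hl.elim
  | _, _, .whisker (.counit _), hl => hl.elim
  | _, _, .whisker (.comul a), _ => by
    have h := evalLayer_comul_assoc hS a
    have h' : ∀ a, S.iteratedCoprod (a + 2) = S.iteratedCoprod (a + 1) ≫ S.evalLayer (.comul a) :=
      fun a => by simp [evalLayer, iteratedCoprod]
    rw [h', Category.assoc, h, ← Category.assoc, ← h', ← h']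
  | _, _, .whisker (.whisker (m := m) (n := n) l), hl => by
    have h := (sim_comul_whisker (S := S) l).1
    have h' : ∀ a, S.iteratedCoprod (a + 2) = S.iteratedCoprod (a + 1) ≫ S.evalLayer (.comul a) :=
      fun a => by simp [evalLayer, iteratedCoprod]
    simp only [evalWord, Category.id_comp] at h
    rw [h', Category.assoc, h, ← Category.assoc, hS.iteratedCoprod_comp_evalLayer l.whisker hl,
      ← h']

theorem IsSpecialFrobenius.evalWord_comp_iteratedProd (hS : S.IsSpecialFrobenius) {m n : ℕ}
    (w : Word m n) (hw : w.All Layer.IsMul) :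
    S.evalWord w ≫ S.iteratedProd n = S.iteratedProd m := by
  induction w with
  | nil => simp [evalWord]
  | snoc w l ih =>
    rw [evalWord, Category.assoc, hS.evalLayer_comp_iteratedProd l hw.2, ih hw.1]

/-- Each coproduct is absorbed into the iterated coproduct. A unit beside an existing strand would
start a second component, so the only possible unit is the first layer when `p = 0`. -/
theorem IsSpecialFrobenius.evalWord_of_isExpansion (hS : S.IsSpecialFrobenius) {p n : ℕ}
    (W : Word p n) (hW : W.All Layer.IsExpansion) (hp : p ≤ 1) (hn : 1 ≤ n)
    (h : ∀ x z, W.Rel x z → ∃ b, x = Col.const b p ∧ z = Col.const b n) :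
    S.evalWord W = S.iteratedProd p ≫ S.iteratedCoprod n := by
  induction W with
  | nil =>
    obtain rfl : p = 1 := le_antisymm hp hn
    simp [evalWord, iteratedProd, iteratedCoprod]
  | @snoc k n W l ih =>
    -- No expansion layer has zero strands below it, so `k = 0` forces the word before `l` to be
    -- empty.
    obtain hk | hk := Nat.eq_zero_or_pos k
    · subst hk
      cases l with
      | one =>
        cases W with
        | nil =>
          simp [evalWord, evalLayer, iteratedProd, iteratedCoprod, tensorPowOne, unit,
            unitors_equal]
        | snoc W l =>
          cases l with
          | counit => exact (or_self_iff.1 hW.1.2).elim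
    · have hb : ∀ b b', Col.const b k = Col.const b' k → b = b' := by
        obtain ⟨k, rfl⟩ := Nat.exists_eq_add_of_lt hk
        intro b b' h
        exact congrArg Prod.snd h
      obtain hl | hl := hW.2
      · rw [evalWord, ih hW.1 hk, Category.assoc, hS.iteratedCoprod_comp_evalLayer l hl]
        intro x y hx
        obtain ⟨z, hz⟩ := hW.2.exists_rel y
        obtain ⟨b, rfl, rfl⟩ := h x z ⟨y, hx, hz⟩
        exact ⟨b, rfl, hW.2.eq_const hz⟩
      -- The new strand can receive a color different from that of the `k ≥ 1` strands beside it,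
      -- against `h`.
      · obtain ⟨z, hz, hz'⟩ := hl.exists_rel_const
        obtain ⟨b, -, rfl⟩ := h _ z ⟨_, W.rel_const false, hz'⟩
        exact absurd (by rw [hb _ _ (hW.2.eq_const hz')]) hz

/-- A connected word with at least one leg out represents the standard form. -/
theorem IsSpecialFrobenius.evalWord_eq_standardForm (hS : S.IsSpecialFrobenius) {m n : ℕ}
    (w : Word m n) (hw : w.ReachesBottom) (hn : 1 ≤ n)
    (h : ∀ x z, w.Rel x z → ∃ b, x = Col.const b m ∧ z = Col.const b n) :
    S.evalWord w = S.standardForm m n := by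
  obtain ⟨p, M, W, hM, hW, hMW⟩ := hS.exists_sim_append w hw
  have hW' : ∀ y z, W.Rel y z → ∃ b, y = Col.const b p ∧ z = Col.const b n := fun y z hy => by
    obtain ⟨x, hx⟩ := exists_rel_of_isMul hM y
    obtain ⟨b, rfl, rfl⟩ := h x z ((hMW.2 _ _).2 ((rel_append _ _ _ _).2 ⟨y, hx, hy⟩))
    exact ⟨b, eq_const_of_isExpansion hW hy, rfl⟩
  -- Two waist strands with different colors would extend upwards through the products and downwards
  -- through the expansions to a two-colored diagram.
  have hp : p ≤ 1 := by
    by_contra! hp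
    obtain ⟨p, rfl⟩ := Nat.exists_eq_add_of_le' hp
    obtain ⟨z, hz⟩ := exists_rel_of_isExpansion hW ((Col.const false p, false), true)
    obtain ⟨b, hb, -⟩ := hW' _ z hz
    simp only [Col.const, Prod.mk.injEq] at hb
    exact Bool.false_ne_true (hb.1.2.trans hb.2.symm)
  rw [hMW.1, evalWord_append, hS.evalWord_of_isExpansion W hW hp hn hW', standardForm,
    ← Category.assoc, hS.evalWord_comp_iteratedProd M hM]

end SpiderOperations

/-! ### Colors that occur in a word, and connected words -/

namespace Col

/-- The set of colors that occur in a coloring. -/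
def colors : {n : ℕ} → Col n → Set Bool
  | 0, _ => ∅
  | _ + 1, x => insert x.2 (colors x.1)

/-- The color of a strand. -/
def get : {n : ℕ} → Col n → Fin n → Bool
  | 0, _ => fun i => i.elim0
  | n + 1, x => fun i => if h : (i : ℕ) < n then get x.1 ⟨i, h⟩ else x.2

/-- The coloring of the first `m` strands. -/
def take (m : ℕ) : {n : ℕ} → Col (m + n) → Col m
  | 0, x => x
  | _ + 1, x => take m x.1

/-- The coloring of the last `n` strands. -/
def drop (m : ℕ) : {n : ℕ} → Col (m + n) → Col n
  | 0, _ => ()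
  | _ + 1, x => (drop m x.1, x.2)

@[simp]
theorem get_last {n : ℕ} (x : Col (n + 1)) : x.get (Fin.last n) = x.2 := by simp [get]

@[simp]
theorem get_castSucc {n : ℕ} (x : Col (n + 1)) (i : Fin n) : x.get i.castSucc = x.1.get i := by
  simp [get]

theorem colors_subset_singleton {n : ℕ} {x : Col n} {b : Bool} :
    x.colors ⊆ {b} ↔ x = const b n := by
  induction n with
  | zero => exact ⟨fun _ => rfl, fun _ => Set.empty_subset _⟩
  | succ n ih =>
    rw [colors, Set.insert_subset_iff, ih, Set.mem_singleton_iff, and_comm]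
    exact ⟨fun h => Prod.ext h.1 h.2, fun h => ⟨congrArg Prod.fst h, congrArg Prod.snd h⟩⟩

theorem range_get {n : ℕ} (x : Col n) : Set.range x.get = x.colors := by
  induction n with
  | zero => exact Set.range_eq_empty _
  | succ n ih =>
    ext b
    rw [colors, ← ih]
    constructor
    · rintro ⟨i, rfl⟩
      induction i using Fin.lastCases with
      | last => simp
      | cast i => simp
    · rintro (rfl | ⟨i, rfl⟩)
      · exact ⟨Fin.last n, by simp⟩
      · exact ⟨i.castSucc, by simp⟩

theorem colors_take_union_drop (m : ℕ) {n : ℕ} (x : Col (m + n)) :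
    x.colors = (x.take m).colors ∪ (x.drop m).colors := by
  induction n with
  | zero => simp [take, colors]
  | succ n ih =>
    change insert _ (colors x.1) = colors (take m x.1) ∪ insert _ (colors (drop m x.1))
    rw [ih, Set.union_insert]
    rfl

theorem get_castAdd {m n : ℕ} (x : Col (m + n)) (i : Fin m) :
    x.get (Fin.castAdd n i) = (x.take m).get i := by
  induction n with
  | zero => rfl
  | succ n ih =>
    rw [take, ← ih]
    exact get_castSucc x (Fin.castAdd n i)

theorem get_natAdd {m n : ℕ} (x : Col (m + n)) (i : Fin n) :
    x.get (Fin.natAdd m i) = (x.drop m).get i := by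
  induction n with
  | zero => exact i.elim0
  | succ n ih =>
    induction i using Fin.lastCases with
    | last =>
      rw [get_last]
      exact get_last x
    | cast i =>
      rw [get_castSucc]
      exact (get_castSucc x (Fin.natAdd m i)).trans (ih x.1 i)

end Col

theorem Layer.rel_whiskerLeft (a : ℕ) {m n : ℕ} (l : Layer m n) {x : Col (a + m)}
    {z : Col (a + n)} (h : (l.whiskerLeft a).Rel x z) :
    l.Rel (x.drop a) (z.drop a) ∧ x.take a = z.take a := by
  induction l with
  | mul k => exact ⟨⟨congrArg (Col.drop a (n := k + 1)) h.1, h.2⟩,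
    congrArg (Col.take a (n := k + 1)) h.1⟩
  | comul k => exact ⟨⟨congrArg (Col.drop a (n := k + 1)) h.1, h.2⟩,
    (congrArg (Col.take a (n := k + 1)) h.1).symm⟩
  | one k => exact ⟨congrArg (Col.drop a (n := k)) h, (congrArg (Col.take a (n := k)) h).symm⟩
  | counit k => exact ⟨congrArg (Col.drop a (n := k)) h, congrArg (Col.take a (n := k)) h⟩
  | whisker l ih => exact ⟨⟨(ih h.1).1, h.2⟩, (ih h.1).2⟩

namespace Word

/-- The word has a coloring with colors `x` above and `z` below, in which the colors that occur at
some level are those in `s`. -/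
def HasColoring {m n : ℕ} : Word m n → Col m → Col n → Set Bool → Prop
  | nil => fun x z s => x = z ∧ s = z.colors
  | snoc w l => fun x z s => ∃ y t, w.HasColoring x y t ∧ l.Rel y z ∧ s = t ∪ z.colors

/-- Every coloring of the word uses only one color. -/
def IsConnected {m n : ℕ} (w : Word m n) : Prop :=
  ∀ x z s, w.HasColoring x z s → s.Subsingleton

/-- The word has no layers. -/
def IsNil {m n : ℕ} : Word m n → Prop
  | nil => True
  | snoc _ _ => False

theorem HasColoring.subset {m n : ℕ} {w : Word m n} {x : Col m} {z : Col n} {s : Set Bool}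
    (h : w.HasColoring x z s) : x.colors ⊆ s ∧ z.colors ⊆ s := by
  induction w generalizing s with
  | nil =>
    obtain ⟨rfl, rfl⟩ := h
    exact ⟨subset_rfl, subset_rfl⟩
  | snoc w l ih =>
    obtain ⟨y, t, h, -, rfl⟩ := h
    exact ⟨(ih h).1.trans Set.subset_union_left, Set.subset_union_right⟩

theorem Rel.exists_hasColoring {m n : ℕ} {w : Word m n} {x : Col m} {z : Col n}
    (h : w.Rel x z) : ∃ s, w.HasColoring x z s := by
  induction w with
  | nil => exact ⟨_, h, rfl⟩
  | snoc w l ih =>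
    obtain ⟨y, hy, hz⟩ := h
    obtain ⟨s, hs⟩ := ih hy
    exact ⟨_, y, s, hs, hz, rfl⟩

theorem hasColoring_append {m k n : ℕ} {u : Word m k} {v : Word k n} {x : Col m} {z : Col n}
    {s : Set Bool} : (u.append v).HasColoring x z s ↔
      ∃ y t t', u.HasColoring x y t ∧ v.HasColoring y z t' ∧ s = t ∪ t' := by
  induction v generalizing s with
  | nil =>
    constructor
    · exact fun h => ⟨z, s, _, h, ⟨rfl, rfl⟩, (Set.union_eq_left.2 h.subset.2).symm⟩
    · rintro ⟨y, t, t', h, ⟨rfl, rfl⟩, rfl⟩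
      rwa [Set.union_eq_left.2 h.subset.2]
  | snoc v l ih =>
    constructor
    · rintro ⟨y, t, h, h', rfl⟩
      obtain ⟨y', t', t'', h₁, h₂, rfl⟩ := ih.1 h
      exact ⟨y', t', _, h₁, ⟨y, t'', h₂, h', rfl⟩, Set.union_assoc _ _ _⟩
    · rintro ⟨y', t', _, h₁, ⟨y, t'', h₂, h', rfl⟩, rfl⟩
      exact ⟨y, _, ih.2 ⟨y', t', t'', h₁, h₂, rfl⟩, h', (Set.union_assoc _ _ _).symm⟩

theorem HasColoring.of_whisker {m n : ℕ} {w : Word m n} {x : Col (m + 1)} {z : Col (n + 1)}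
    {s : Set Bool} (h : w.whisker.HasColoring x z s) :
    ∃ t, w.HasColoring x.1 z.1 t ∧ x.2 = z.2 ∧ s = insert x.2 t := by
  induction w generalizing s with
  | nil =>
    obtain ⟨rfl, rfl⟩ := h
    exact ⟨_, ⟨rfl, rfl⟩, rfl, rfl⟩
  | snoc w l ih =>
    obtain ⟨y, t, h, ⟨h', h''⟩, rfl⟩ := h
    obtain ⟨t, h₁, h₂, rfl⟩ := ih h
    refine ⟨_, ⟨y.1, t, h₁, h', rfl⟩, h₂.trans h'', ?_⟩
    rw [Col.colors, ← h'', ← h₂]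
    ext
    simp
    tauto

theorem HasColoring.of_whiskerRight {m n : ℕ} {w : Word m n} {b : ℕ} {x : Col (m + b)}
    {z : Col (n + b)} {s : Set Bool} (h : (w.whiskerRight b).HasColoring x z s) :
    ∃ t, w.HasColoring (x.take m) (z.take n) t ∧ x.drop m = z.drop n ∧
      s = t ∪ (x.drop m).colors := by
  induction b generalizing s with
  | zero => exact ⟨s, h, rfl, (Set.union_empty s).symm⟩
  | succ b ih =>
    obtain ⟨t, ht, h', rfl⟩ := HasColoring.of_whisker h
    obtain ⟨t, h₁, h₂, rfl⟩ := ih ht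
    exact ⟨t, h₁, Prod.ext h₂ h', Set.union_insert.symm⟩

theorem HasColoring.of_whiskerLeft {a m n : ℕ} {w : Word m n} {x : Col (a + m)}
    {z : Col (a + n)} {s : Set Bool} (h : (w.whiskerLeft a).HasColoring x z s) :
    ∃ t, w.HasColoring (x.drop a) (z.drop a) t ∧ x.take a = z.take a ∧
      s = t ∪ (x.take a).colors := by
  induction w generalizing s with
  | nil =>
    obtain ⟨rfl, rfl⟩ := h
    exact ⟨_, ⟨rfl, rfl⟩, rfl, (Col.colors_take_union_drop _ _).trans (Set.union_comm _ _)⟩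
  | snoc w l ih =>
    obtain ⟨y, t, h, h', rfl⟩ := h
    obtain ⟨t, h₁, h₂, rfl⟩ := ih h
    obtain ⟨h₃, h₄⟩ := l.rel_whiskerLeft a h'
    refine ⟨_, ⟨_, t, h₁, h₃, rfl⟩, h₂.trans h₄, ?_⟩
    rw [Col.colors_take_union_drop a z, ← h₄, ← h₂]
    ext
    simp
    tauto

/-- A component of an initial segment that misses its bottom is a component of the whole word. In
terms of colorings, one that is constant at the end of the segment continues constantly through the
next layer. -/
theorem reachesBottom_of_forall_subset {m n : ℕ} {w : Word m n}
    (h : ∀ x s, w.HasColoring x (Col.const false n) s → s ⊆ {false}) : w.ReachesBottom := by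
  induction w with
  | nil => trivial
  | snoc w l ih =>
    refine ⟨ih fun x s hs => ?_, fun x y hxy hy => ?_⟩
    · exact Set.subset_union_left.trans (h x _ ⟨_, s, hs, l.rel_const false, rfl⟩)
    · obtain ⟨s, hs⟩ := Rel.exists_hasColoring hxy
      exact Col.colors_subset_singleton.1 <| hs.subset.2.trans <|
        Set.subset_union_left.trans (h x _ ⟨y, s, hs, hy, rfl⟩)

theorem IsConnected.reachesBottom {m n : ℕ} {w : Word m (n + 1)} (h : w.IsConnected) :
    w.ReachesBottom :=
  reachesBottom_of_forall_subset fun _ _ hs _ hb =>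
    h _ _ _ hs hb (hs.subset.2 (Set.mem_insert _ _))

theorem IsConnected.eq_const {m n : ℕ} {w : Word m (n + 1)} (h : w.IsConnected)
    (x : Col m) (z : Col (n + 1)) (hx : w.Rel x z) :
    ∃ b, x = Col.const b m ∧ z = Col.const b (n + 1) := by
  obtain ⟨s, hs⟩ := Rel.exists_hasColoring hx
  have hs' : s ⊆ {z.2} := fun _ hb => h _ _ _ hs hb (hs.subset.2 (Set.mem_insert _ _))
  exact ⟨z.2, Col.colors_subset_singleton.1 (hs.subset.1.trans hs'),
    Col.colors_subset_singleton.1 (hs.subset.2.trans hs')⟩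

/-- The last leg in is split and the copy led down on the right, which produces a leg out. The copy
has the color of that leg, so no new color appears. -/
theorem IsConnected.comul_append_whisker {m : ℕ} {w : Word (m + 1) 0} (h : w.IsConnected) :
    ((single (.comul m)).append w.whisker).IsConnected := by
  intro x z s hs
  obtain ⟨y, t, t', ⟨_, _, ⟨rfl, rfl⟩, ⟨hy, hy'⟩, rfl⟩, h', rfl⟩ := hasColoring_append.1 hs
  obtain ⟨t, ht, -, rfl⟩ := h'.of_whisker
  refine (h _ _ _ ht).anti ?_
  have h₁ := ht.subset.1
  rw [hy] at h₁
  have h₂ : y.2 ∈ t := hy' ▸ h₁ (Set.mem_insert _ _)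
  have h₃ : y.colors ⊆ t := Set.insert_subset h₂ (hy.symm ▸ h₁)
  exact Set.union_subset (Set.union_subset h₁ h₃) (Set.insert_subset h₂ subset_rfl)

/-- Only a unit can be applied to zero strands. -/
theorem isNil_or_exists_eq_append {n : ℕ} (w : Word 0 n) :
    w.IsNil ∨ ∃ w' : Word 1 n, w = (single (.one 0)).append w' := by
  induction w with
  | nil => exact .inl trivial
  | snoc w l ih =>
    obtain h | ⟨w', rfl⟩ := ih
    · cases w with
      | nil =>
        cases l with
        | one => exact .inr ⟨nil, rfl⟩
      | snoc w l => exact h.elim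
    · exact .inr ⟨w'.snoc l, rfl⟩

theorem IsConnected.of_one_append {n : ℕ} {w : Word 1 n}
    (h : ((single (.one 0)).append w).IsConnected) : w.IsConnected := fun x _ _ hs =>
  (h () _ _ (hasColoring_append.2
    ⟨x, _, _, ⟨(), _, ⟨rfl, rfl⟩, Subsingleton.elim _ _, rfl⟩, hs, rfl⟩)).anti
      Set.subset_union_right

end Word

/-! ### Connectedness: from diagrams to words -/

namespace PlanarDiagram

/-- A word that represents the same morphism as the diagram. -/
def toWord {m n : ℕ} : PlanarDiagram m n → Word m n
  | strands _ => .nil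
  | cup => (Word.single (.mul 0)).snoc (.counit 0)
  | cap => (Word.single (.one 0)).snoc (.comul 0)
  | prod => Word.single (.mul 0)
  | coprod => Word.single (.comul 0)
  | comp d e => d.toWord.append e.toWord
  | juxt (n := n) (m' := m') d e => (d.toWord.whiskerRight m').append (e.toWord.whiskerLeft n)

/-- This transfers connectedness: a word coloring is read off at the vertices. Equality of the color
sets ensures that no color is lost, even on a component without legs. -/
theorem exists_coloring {m n : ℕ} (d : PlanarDiagram m n) {x : Col m} {z : Col n} {s : Set Bool}
    (h : d.toWord.HasColoring x z s) :
    ∃ c : d.Vertex → Bool, (∀ u v, d.Link u v → c u = c v) ∧ (∀ i, x.get i = c (d.legIn i)) ∧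
      (∀ i, z.get i = c (d.legOut i)) ∧ Set.range c = s := by
  induction d generalizing s with
  | strands n =>
    obtain ⟨rfl, rfl⟩ := h
    exact ⟨x.get, fun _ _ => False.elim, fun _ => rfl, fun _ => rfl, x.range_get⟩
  | cup =>
    obtain ⟨y, t, ⟨y', t', ⟨rfl, rfl⟩, h₁, rfl⟩, h₂, rfl⟩ := h
    refine ⟨fun _ => x.2, fun _ _ => False.elim, fun i => ?_, fun i => i.elim0, ?_⟩
    · fin_cases i <;> simp_all [Layer.Rel, Col.get]
    · simp_all [Layer.Rel, Col.colors]
  | cap =>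
    obtain ⟨y, t, ⟨y', t', ⟨rfl, rfl⟩, h₁, rfl⟩, h₂, rfl⟩ := h
    refine ⟨fun _ => z.2, fun _ _ => False.elim, fun i => i.elim0, fun i => ?_, ?_⟩
    · fin_cases i <;> simp_all [Layer.Rel, Col.get]
    · simp_all [Layer.Rel, Col.colors]
  | prod =>
    obtain ⟨y', t', ⟨rfl, rfl⟩, h₁, rfl⟩ := h
    refine ⟨fun _ => x.2, fun _ _ => False.elim, fun i => ?_, fun i => ?_, ?_⟩
    · fin_cases i <;> simp_all [Layer.Rel, Col.get]
    · fin_cases i; simp_all [Layer.Rel, Col.get]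
    · simp_all [Layer.Rel, Col.colors]
  | coprod =>
    obtain ⟨y', t', ⟨rfl, rfl⟩, h₁, rfl⟩ := h
    refine ⟨fun _ => x.2, fun _ _ => False.elim, fun i => ?_, fun i => ?_, ?_⟩
    · fin_cases i; simp_all [Layer.Rel, Col.get]
    · fin_cases i <;> simp_all [Layer.Rel, Col.get]
    · simp_all [Layer.Rel, Col.colors]
  | comp d e ihd ihe =>
    obtain ⟨y, t, t', ht, ht', rfl⟩ := Word.hasColoring_append.1 h
    obtain ⟨c, hc, hx, hy, rfl⟩ := ihd ht
    obtain ⟨c', hc', hy', hz, rfl⟩ := ihe ht'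
    refine ⟨Sum.elim c c', ?_, hx, hz, Set.Sum.elim_range c c'⟩
    rintro u v ((⟨h⟩ | ⟨h⟩) | ⟨i, rfl, rfl⟩)
    · exact hc _ _ h
    · exact hc' _ _ h
    · exact (hy i).symm.trans (hy' i)
  | @juxt m n m' n' d e ihd ihe =>
    obtain ⟨y, t, t', ht, ht', rfl⟩ := Word.hasColoring_append.1 h
    obtain ⟨t, hd, h₁, rfl⟩ := ht.of_whiskerRight
    obtain ⟨t', he, h₂, rfl⟩ := ht'.of_whiskerLeft
    -- The strands added beside each factor are legs of the other one, so their colors are already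
    -- counted.
    have h₃ : t ∪ (x.drop m).colors ∪ (t' ∪ (y.take n).colors) = t ∪ t' := by
      refine subset_antisymm (Set.union_subset (Set.union_subset_union_right _ (h₁ ▸ he.subset.1))
        (Set.union_subset Set.subset_union_right (hd.subset.2.trans Set.subset_union_left)))
        (Set.union_subset_union Set.subset_union_left Set.subset_union_left)
    rw [h₃]
    rw [← h₁] at he
    rw [h₂] at hd
    obtain ⟨c, hc, hx, hz, rfl⟩ := ihd hd
    obtain ⟨c', hc', hx', hz', rfl⟩ := ihe he
    refine ⟨Sum.elim c c', ?_, fun i => ?_, fun i => ?_, ?_⟩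
    · rintro u v (⟨h⟩ | ⟨h⟩)
      · exact hc _ _ h
      · exact hc' _ _ h
    · induction i using Fin.addCases with
      | left i => simp [Col.get_castAdd, legIn, hx]
      | right i => simp [Col.get_natAdd, legIn, hx']
    · induction i using Fin.addCases with
      | left i => simp [Col.get_castAdd, legOut, hz]
      | right i => simp [Col.get_natAdd, legOut, hz']
    · exact Set.Sum.elim_range c c'

theorem IsConnected.eq_of_link {m n : ℕ} {d : PlanarDiagram m n} (h : d.IsConnected)
    {β : Type*} {c : d.Vertex → β} (hc : ∀ u v, d.Link u v → c u = c v) (u v : d.Vertex) :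
    c u = c v := by
  obtain ⟨p⟩ := h.preconnected u v
  induction p with
  | nil => rfl
  | cons h p ih =>
    refine Eq.trans ?_ ih
    obtain ⟨-, h | h⟩ := (SimpleGraph.fromRel_adj _ _ _).1 h
    · exact hc _ _ h
    · exact (hc _ _ h).symm

theorem IsConnected.toWord {m n : ℕ} {d : PlanarDiagram m n} (h : d.IsConnected) :
    d.toWord.IsConnected := by
  intro x z s hs
  obtain ⟨c, hc, -, -, rfl⟩ := d.exists_coloring hs
  rintro _ ⟨u, rfl⟩ _ ⟨v, rfl⟩
  exact h.eq_of_link hc u v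

/-- A word without layers on zero strands has a coloring with no colors, while a connected diagram
has a vertex to be colored. -/
theorem IsConnected.not_isNil {d : PlanarDiagram 0 0} (h : d.IsConnected) :
    ¬ d.toWord.IsNil := by
  intro hd
  have hd' : d.toWord.HasColoring () () ∅ := by
    revert hd
    generalize d.toWord = w
    intro hw
    cases w with
    | nil => exact ⟨rfl, rfl⟩
    | snoc w l => exact hw.elim
  obtain ⟨c, -, -, -, hc⟩ := d.exists_coloring hd'
  have := h.nonempty
  exact (Set.range_nonempty c).ne_empty hc

end PlanarDiagram

/-! ### Evaluation of diagrams through words, and the spider property -/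

namespace SpiderOperations

variable {C : Type u} [Category.{v} C] [MonoidalCategory C] {A : C} {S : SpiderOperations A}

variable (S) in
theorem evalWord_whiskerRight {m n : ℕ} (w : Word m n) (b : ℕ) :
    S.evalWord (w.whiskerRight b) = (tensorPowAdd A m b).inv ≫ S.evalWord w ▷ tensorPow A b ≫
      (tensorPowAdd A n b).hom := by
  induction b with
  | zero => simp [Word.whiskerRight, tensorPowAdd]
  | succ b ih => simp [Word.whiskerRight, evalWord_whisker, tensorPowAdd, ih]

/-- Used to replace the power `tensorPow A (a + k)` by the tensor product of two powers, where
coherence applies. -/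
theorem whiskerLeft_eq_of_iso {X Y : C} (i : X ≅ Y) {Z W : C} (f : Z ⟶ W) :
    Y ◁ f = i.inv ▷ Z ≫ X ◁ f ≫ i.hom ▷ W := by
  rw [whisker_exchange, inv_hom_whiskerRight_assoc]

variable (S) in
theorem evalLayer_whiskerLeft (a : ℕ) {m n : ℕ} (l : Layer m n) :
    S.evalLayer (l.whiskerLeft a) = (tensorPowAdd A a m).inv ≫ tensorPow A a ◁ S.evalLayer l ≫
      (tensorPowAdd A a n).hom := by
  induction l with
  | mul k =>
    simp only [Layer.whiskerLeft, evalLayer, tensorPowAdd,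
      whiskerLeft_eq_of_iso (tensorPowAdd A a k)]
    simp
  | comul k =>
    simp only [Layer.whiskerLeft, evalLayer, tensorPowAdd,
      whiskerLeft_eq_of_iso (tensorPowAdd A a k)]
    simp
  | one k =>
    simp only [Layer.whiskerLeft, evalLayer, tensorPowAdd,
      whiskerLeft_eq_of_iso (tensorPowAdd A a k)]
    simp
  | counit k =>
    simp only [Layer.whiskerLeft, evalLayer, tensorPowAdd,
      whiskerLeft_eq_of_iso (tensorPowAdd A a k)]
    simp
  | whisker l ih => simp [Layer.whiskerLeft, evalLayer, tensorPowAdd, ih]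

variable (S) in
theorem evalWord_whiskerLeft (a : ℕ) {m n : ℕ} (w : Word m n) :
    S.evalWord (w.whiskerLeft a) = (tensorPowAdd A a m).inv ≫ tensorPow A a ◁ S.evalWord w ≫
      (tensorPowAdd A a n).hom := by
  induction w with
  | nil => simp [Word.whiskerLeft, evalWord]
  | snoc w l ih => simp [Word.whiskerLeft, evalWord, evalLayer_whiskerLeft, ih]

theorem IsSpecialFrobenius.evalWord_toWord (hS : S.IsSpecialFrobenius) {m n : ℕ}
    (d : PlanarDiagram m n) : S.evalWord d.toWord = S.eval d := by
  induction d with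
  | strands n => rfl
  | cup =>
    simp [PlanarDiagram.toWord, evalWord, evalLayer, eval, hS.cup_eq, tensorPowTwo, tensorPow,
      ← unitors_equal]
  | cap =>
    simp [PlanarDiagram.toWord, evalWord, evalLayer, eval, hS.cap_eq, tensorPowTwo, unitors_equal]
  | prod =>
    simp [PlanarDiagram.toWord, evalWord, evalLayer, eval, tensorPowTwo, tensorPowOne]
  | coprod =>
    simp [PlanarDiagram.toWord, evalWord, evalLayer, eval, tensorPowTwo, tensorPowOne]
  | comp d e ihd ihe => simp [PlanarDiagram.toWord, evalWord_append, eval, ihd, ihe]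
  | juxt d e ihd ihe =>
    simp [PlanarDiagram.toWord, evalWord_append, evalWord_whiskerRight, evalWord_whiskerLeft, eval,
      ihd, ihe, MonoidalCategory.tensorHom_def]

/-- By interchange the counit slides up along the added strand to the coproduct, where the counit
law cancels both. -/
theorem IsSpecialFrobenius.evalWord_comul_append_whisker_counit (hS : S.IsSpecialFrobenius) {m : ℕ}
    (w : Word (m + 1) 0) :
    S.evalWord ((Word.single (.comul m)).append w.whisker) ≫ S.evalLayer (.counit 0) =
      S.evalWord w := by
  have h := (sim_comul_counit hS m).1
  simp only [evalWord, Category.id_comp] at h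
  rw [evalWord_append, evalWord_whisker, Category.assoc]
  simp only [evalWord, evalLayer, Category.id_comp, Category.assoc] at h ⊢
  rw [← whisker_exchange_assoc, rightUnitor_naturality, reassoc_of% h]

theorem IsSpecialFrobenius.evalWord_eq_standardForm_zero (hS : S.IsSpecialFrobenius) {m : ℕ}
    (w : Word (m + 1) 0) (hw : w.IsConnected) : S.evalWord w = S.standardForm (m + 1) 0 := by
  have hw' := hw.comul_append_whisker
  have h := hS.evalWord_eq_standardForm _ hw'.reachesBottom le_rfl hw'.eq_const
  rw [← hS.evalWord_comul_append_whisker_counit, h]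
  simp only [standardForm, iteratedCoprod, evalLayer, tensorPowOne, tensorPow, Category.assoc]
  simp [← unitors_equal, hS.cup_eq, reassoc_of% hS.special]

theorem IsSpecialFrobenius.isPlanarSpider (hS : S.IsSpecialFrobenius) : S.IsPlanarSpider := by
  intro m n d hd
  rw [← hS.evalWord_toWord]
  have hw := hd.toWord
  match m, n, d with
  | m, n + 1, d => exact hS.evalWord_eq_standardForm _ hw.reachesBottom (by omega) hw.eq_const
  | m + 1, 0, d => exact hS.evalWord_eq_standardForm_zero _ hw
  | 0, 0, d =>
    obtain h | ⟨w, h⟩ := d.toWord.isNil_or_exists_eq_append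
    · exact absurd h hd.not_isNil
    -- The initial unit is `prod ∘ cap`, the product part of the standard form for `m = 0`; the
    -- remaining word has one leg in.
    · rw [h] at hw ⊢
      rw [evalWord_append, hS.evalWord_eq_standardForm_zero _ hw.of_one_append]
      simp [evalWord, evalLayer, standardForm, iteratedProd, tensorPowOne, unit, unitors_equal]

end SpiderOperations

/-! ### The connected diagrams behind the axioms -/

namespace PlanarDiagram

/-- Reachability from a fixed vertex is itself a coloring constant along links, with propositions as
colors. -/
theorem isConnected_of_forall_coloring {m n : ℕ} {d : PlanarDiagram m n} (r : d.Vertex)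
    (h : ∀ c : d.Vertex → Prop, (∀ u v, d.Link u v → c u = c v) → ∀ u, c u = c r) :
    d.IsConnected := by
  have : Nonempty d.Vertex := ⟨r⟩
  refine ⟨fun u v => ?_⟩
  have key := h (fun w => (SimpleGraph.fromRel d.Link).Reachable u w) fun x y hxy => by
    by_cases hne : x = y
    · rw [hne]
    · have hadj : (SimpleGraph.fromRel d.Link).Adj x y :=
        (SimpleGraph.fromRel_adj _ _ _).2 ⟨hne, .inl hxy⟩
      exact propext ⟨fun h => h.trans hadj.reachable, fun h => h.trans hadj.symm.reachable⟩
  rw [key v, ← key u]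

theorem forall_coloring_comp {m k n : ℕ} {d : PlanarDiagram m k} {e : PlanarDiagram k n}
    {β : Type*} {c : (comp d e).Vertex → β} (hc : ∀ u v, (comp d e).Link u v → c u = c v) :
    (∀ u v, d.Link u v → c (.inl u) = c (.inl v)) ∧
      (∀ u v, e.Link u v → c (.inr u) = c (.inr v)) ∧
      ∀ i, c (.inl (d.legOut i)) = c (.inr (e.legIn i)) :=
  ⟨fun _ _ h => hc _ _ (.inl (.inl h)), fun _ _ h => hc _ _ (.inl (.inr h)),
    fun i => hc _ _ (.inr ⟨i, rfl, rfl⟩)⟩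

theorem forall_coloring_juxt {m k m' k' : ℕ} {d : PlanarDiagram m k} {e : PlanarDiagram m' k'}
    {β : Type*} {c : (juxt d e).Vertex → β} (hc : ∀ u v, (juxt d e).Link u v → c u = c v) :
    (∀ u v, d.Link u v → c (.inl u) = c (.inl v)) ∧
      (∀ u v, e.Link u v → c (.inr u) = c (.inr v)) :=
  ⟨fun _ _ h => hc _ _ (.inl h), fun _ _ h => hc _ _ (.inr h)⟩

theorem isConnected_cup :
    (cup).IsConnected := by
  refine isConnected_of_forall_coloring () fun c hc => ?_
  rintro ⟨⟩
  · exact rfl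

theorem isConnected_cap :
    (cap).IsConnected := by
  refine isConnected_of_forall_coloring () fun c hc => ?_
  rintro ⟨⟩
  · exact rfl

theorem isConnected_prod_juxt_strand_comp_prod :
    (comp (juxt prod (strands 1)) prod).IsConnected := by
  refine isConnected_of_forall_coloring (.inr ()) fun c hc => ?_
  obtain ⟨-, -, h'⟩ := forall_coloring_comp hc
  have h₀ : c (.inl (.inl ())) = c (.inr ()) := h' 0
  have h₁ : c (.inl (.inr 0)) = c (.inr ()) := h' 1
  rintro ((⟨⟩ | i) | ⟨⟩)
  · exact h₀
  · obtain rfl := Subsingleton.elim i 0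
    exact h₁
  · exact rfl

theorem isConnected_strand_juxt_prod_comp_prod :
    (comp (juxt (strands 1) prod) prod).IsConnected := by
  refine isConnected_of_forall_coloring (.inr ()) fun c hc => ?_
  obtain ⟨-, -, h'⟩ := forall_coloring_comp hc
  have h₀ : c (.inl (.inl 0)) = c (.inr ()) := h' 0
  have h₁ : c (.inl (.inr ())) = c (.inr ()) := h' 1
  rintro ((i | ⟨⟩) | ⟨⟩)
  · obtain rfl := Subsingleton.elim i 0
    exact h₀
  · exact h₁
  · exact rfl

theorem isConnected_unit_juxt_strand_comp_prod :
    (comp (juxt (comp cap prod) (strands 1)) prod).IsConnected := by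
  refine isConnected_of_forall_coloring (.inr ()) fun c hc => ?_
  obtain ⟨h, -, h'⟩ := forall_coloring_comp hc
  obtain ⟨-, -, h⟩ := forall_coloring_comp (forall_coloring_juxt h).1
  have h₀ : c (.inl (.inl (.inr ()))) = c (.inr ()) := h' 0
  have h₁ : c (.inl (.inr 0)) = c (.inr ()) := h' 1
  rintro (((⟨⟩ | ⟨⟩) | i) | ⟨⟩)
  · exact (h 0).trans h₀
  · exact h₀
  · obtain rfl := Subsingleton.elim i 0
    exact h₁
  · exact rfl

theorem isConnected_strand_juxt_unit_comp_prod :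
    (comp (juxt (strands 1) (comp cap prod)) prod).IsConnected := by
  refine isConnected_of_forall_coloring (.inr ()) fun c hc => ?_
  obtain ⟨h, -, h'⟩ := forall_coloring_comp hc
  obtain ⟨-, -, h⟩ := forall_coloring_comp (forall_coloring_juxt h).2
  have h₀ : c (.inl (.inl 0)) = c (.inr ()) := h' 0
  have h₁ : c (.inl (.inr (.inr ()))) = c (.inr ()) := h' 1
  rintro ((i | (⟨⟩ | ⟨⟩)) | ⟨⟩)
  · obtain rfl := Subsingleton.elim i 0
    exact h₀
  · exact (h 0).trans h₁
  · exact h₁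
  · exact rfl

theorem isConnected_coprod_comp_coprod_juxt_strand :
    (comp coprod (juxt coprod (strands 1))).IsConnected := by
  refine isConnected_of_forall_coloring (.inl ()) fun c hc => ?_
  obtain ⟨-, -, h'⟩ := forall_coloring_comp hc
  have h₀ : c (.inl ()) = c (.inr (.inl ())) := h' 0
  have h₁ : c (.inl ()) = c (.inr (.inr 0)) := h' 1
  rintro (⟨⟩ | (⟨⟩ | i))
  · exact rfl
  · exact h₀.symm
  · obtain rfl := Subsingleton.elim i 0
    exact h₁.symm

theorem isConnected_coprod_comp_strand_juxt_coprod :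
    (comp coprod (juxt (strands 1) coprod)).IsConnected := by
  refine isConnected_of_forall_coloring (.inl ()) fun c hc => ?_
  obtain ⟨-, -, h'⟩ := forall_coloring_comp hc
  have h₀ : c (.inl ()) = c (.inr (.inl 0)) := h' 0
  have h₁ : c (.inl ()) = c (.inr (.inr ())) := h' 1
  rintro (⟨⟩ | (i | ⟨⟩))
  · exact rfl
  · obtain rfl := Subsingleton.elim i 0
    exact h₀.symm
  · exact h₁.symm

theorem isConnected_coprod_comp_counit_juxt_strand :
    (comp coprod (juxt (comp coprod cup) (strands 1))).IsConnected := by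
  refine isConnected_of_forall_coloring (.inl ()) fun c hc => ?_
  obtain ⟨-, h, h'⟩ := forall_coloring_comp hc
  obtain ⟨-, -, h⟩ := forall_coloring_comp (forall_coloring_juxt h).1
  have h₀ : c (.inl ()) = c (.inr (.inl (.inl ()))) := h' 0
  have h₁ : c (.inl ()) = c (.inr (.inr 0)) := h' 1
  rintro (⟨⟩ | ((⟨⟩ | ⟨⟩) | i))
  · exact rfl
  · exact h₀.symm
  · exact (h₀.trans (h 0)).symm
  · obtain rfl := Subsingleton.elim i 0
    exact h₁.symm

theorem isConnected_coprod_comp_strand_juxt_counit :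
    (comp coprod (juxt (strands 1) (comp coprod cup))).IsConnected := by
  refine isConnected_of_forall_coloring (.inl ()) fun c hc => ?_
  obtain ⟨-, h, h'⟩ := forall_coloring_comp hc
  obtain ⟨-, -, h⟩ := forall_coloring_comp (forall_coloring_juxt h).2
  have h₀ : c (.inl ()) = c (.inr (.inl 0)) := h' 0
  have h₁ : c (.inl ()) = c (.inr (.inr (.inl ()))) := h' 1
  rintro (⟨⟩ | (i | (⟨⟩ | ⟨⟩)))
  · exact rfl
  · obtain rfl := Subsingleton.elim i 0
    exact h₀.symm
  · exact h₁.symm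
  · exact (h₁.trans (h 0)).symm

theorem isConnected_strand_juxt_coprod_comp_prod_juxt_strand :
    (comp (k := 3) (juxt (strands 1) coprod) (juxt prod (strands 1))).IsConnected := by
  refine isConnected_of_forall_coloring (.inr (.inl ())) fun c hc => ?_
  obtain ⟨-, -, h'⟩ := forall_coloring_comp hc
  have h₀ : c (.inl (.inl 0)) = c (.inr (.inl ())) := h' 0
  have h₁ : c (.inl (.inr ())) = c (.inr (.inl ())) := h' 1
  have h₂ : c (.inl (.inr ())) = c (.inr (.inr 0)) := h' 2
  rintro ((i | ⟨⟩) | (⟨⟩ | i))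
  · obtain rfl := Subsingleton.elim i 0
    exact h₀
  · exact h₁
  · exact rfl
  · obtain rfl := Subsingleton.elim i 0
    exact h₂.symm.trans h₁

theorem isConnected_coprod_juxt_strand_comp_strand_juxt_prod :
    (comp (k := 3) (juxt coprod (strands 1)) (juxt (strands 1) prod)).IsConnected := by
  refine isConnected_of_forall_coloring (.inr (.inr ())) fun c hc => ?_
  obtain ⟨-, -, h'⟩ := forall_coloring_comp hc
  have h₀ : c (.inl (.inl ())) = c (.inr (.inl 0)) := h' 0
  have h₁ : c (.inl (.inl ())) = c (.inr (.inr ())) := h' 1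
  have h₂ : c (.inl (.inr 0)) = c (.inr (.inr ())) := h' 2
  rintro ((⟨⟩ | i) | (i | ⟨⟩))
  · exact h₁
  · obtain rfl := Subsingleton.elim i 0
    exact h₂
  · obtain rfl := Subsingleton.elim i 0
    exact h₀.symm.trans h₁
  · exact rfl

theorem isConnected_prod_comp_coprod :
    (comp prod coprod).IsConnected := by
  refine isConnected_of_forall_coloring (.inr ()) fun c hc => ?_
  obtain ⟨-, -, h'⟩ := forall_coloring_comp hc
  rintro (⟨⟩ | ⟨⟩)
  · exact h' 0
  · exact rfl

theorem isConnected_coprod_comp_prod :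
    (comp coprod prod).IsConnected := by
  refine isConnected_of_forall_coloring (.inr ()) fun c hc => ?_
  obtain ⟨-, -, h'⟩ := forall_coloring_comp hc
  rintro (⟨⟩ | ⟨⟩)
  · exact h' 0
  · exact rfl

theorem isConnected_prod_comp_counit :
    (comp prod (comp coprod cup)).IsConnected := by
  refine isConnected_of_forall_coloring (.inr (.inl ())) fun c hc => ?_
  obtain ⟨-, h, h'⟩ := forall_coloring_comp hc
  obtain ⟨-, -, h⟩ := forall_coloring_comp h
  rintro (⟨⟩ | (⟨⟩ | ⟨⟩))
  · exact h' 0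
  · exact rfl
  · exact (h 0).symm

theorem isConnected_unit_comp_coprod :
    (comp (comp cap prod) coprod).IsConnected := by
  refine isConnected_of_forall_coloring (.inl (.inr ())) fun c hc => ?_
  obtain ⟨h, -, h'⟩ := forall_coloring_comp hc
  obtain ⟨-, -, h⟩ := forall_coloring_comp h
  rintro ((⟨⟩ | ⟨⟩) | ⟨⟩)
  · exact h 0
  · exact rfl
  · exact (h' 0).symm

end PlanarDiagram

/-! ### The Frobenius axioms from the spider property -/

namespace SpiderOperations

variable {C : Type u} [Category.{v} C] [MonoidalCategory C] {A : C} {S : SpiderOperations A}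

theorem IsPlanarSpider.eval_eq (hS : S.IsPlanarSpider) {m n : ℕ} {d e : PlanarDiagram m n}
    (hd : d.IsConnected) (he : e.IsConnected) : S.eval d = S.eval e :=
  (hS _ _ _ hd).trans (hS _ _ _ he).symm

open PlanarDiagram

theorem IsPlanarSpider.isSpecialFrobenius (hS : S.IsPlanarSpider) : S.IsSpecialFrobenius where
  unit_prod := by
    have h := hS _ _ _ isConnected_unit_juxt_strand_comp_prod
    simp only [eval, tensorPow, tensorPowAdd, tensorPowOne, tensorPowTwo, standardForm,
      iteratedProd, iteratedCoprod] at h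
    -- Composition with canonical isomorphisms gives both sides the source and target of `h`, which
    -- are left-bracketed powers starting from the unit object; an identity stands where they
    -- already agree. The other fields follow the same pattern.
    refine (cancel_epi (𝟙 (𝟙_ C ⊗ A))).1 ((cancel_mono (λ_ A).inv).1 ?_)
    exact Eq.trans (by simp [unit]) (h.trans (by simp))
  prod_unit := by
    have h := hS _ _ _ isConnected_strand_juxt_unit_comp_prod
    simp only [eval, tensorPow, tensorPowAdd, tensorPowOne, tensorPowTwo, standardForm,
      iteratedProd, iteratedCoprod] at h
    refine (cancel_epi ((λ_ A).hom ≫ (ρ_ A).inv)).1 ((cancel_mono (λ_ A).inv).1 ?_)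
    exact Eq.trans (by simp [unit]; monoidal) (h.trans (by simp))
  prod_assoc := by
    have h := hS.eval_eq (m := 3) (n := 1) isConnected_prod_juxt_strand_comp_prod
      isConnected_strand_juxt_prod_comp_prod
    simp only [eval, tensorPow, tensorPowAdd, tensorPowOne, tensorPowTwo] at h
    refine (cancel_epi ((λ_ A).hom ▷ A ▷ A)).1 ((cancel_mono (λ_ A).inv).1 ?_)
    exact Eq.trans (by simp; monoidal) (h.trans (by simp; monoidal))
  coprod_counit_left := by
    have h := hS _ _ _ isConnected_coprod_comp_counit_juxt_strand
    simp only [eval, tensorPow, tensorPowAdd, tensorPowOne, tensorPowTwo, standardForm,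
      iteratedProd, iteratedCoprod] at h
    refine (cancel_epi (λ_ A).hom).1 ((cancel_mono (𝟙 (𝟙_ C ⊗ A))).1 ?_)
    exact Eq.trans (by simp [counit]) (h.trans (by simp))
  coprod_counit_right := by
    have h := hS _ _ _ isConnected_coprod_comp_strand_juxt_counit
    simp only [eval, tensorPow, tensorPowAdd, tensorPowOne, tensorPowTwo, standardForm,
      iteratedProd, iteratedCoprod] at h
    refine (cancel_epi (λ_ A).hom).1 ((cancel_mono ((ρ_ A).hom ≫ (λ_ A).inv)).1 ?_)
    exact Eq.trans (by simp [counit]; monoidal) (h.trans (by simp))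
  coprod_assoc := by
    have h := hS.eval_eq (m := 1) (n := 3) isConnected_coprod_comp_strand_juxt_coprod
      isConnected_coprod_comp_coprod_juxt_strand
    simp only [eval, tensorPow, tensorPowAdd, tensorPowOne, tensorPowTwo] at h
    refine (cancel_epi (λ_ A).hom).1 ((cancel_mono ((λ_ (A ⊗ A ⊗ A)).inv ≫
      (α_ (𝟙_ C) A (A ⊗ A)).inv ≫ (α_ (𝟙_ C ⊗ A) A A).inv)).1 ?_)
    exact Eq.trans (by simp; monoidal) (h.trans (by simp))
  frobenius_left := by
    have h := hS.eval_eq (m := 2) (n := 2)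
      isConnected_strand_juxt_coprod_comp_prod_juxt_strand
      isConnected_prod_comp_coprod
    simp only [eval, tensorPow, tensorPowAdd, tensorPowOne, tensorPowTwo] at h
    refine (cancel_epi ((λ_ A).hom ▷ A)).1 ((cancel_mono ((λ_ A).inv ▷ A)).1 ?_)
    exact Eq.trans (by simp; monoidal) (h.trans (by simp))
  frobenius_right := by
    have h := hS.eval_eq (m := 2) (n := 2) isConnected_coprod_juxt_strand_comp_strand_juxt_prod
      isConnected_prod_comp_coprod
    simp only [eval, tensorPow, tensorPowAdd, tensorPowOne, tensorPowTwo] at h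
    refine (cancel_epi ((λ_ A).hom ▷ A)).1 ((cancel_mono ((λ_ A).inv ▷ A)).1 ?_)
    exact Eq.trans (by simp; monoidal) (h.trans (by simp))
  special := by
    have h := hS _ _ _ isConnected_coprod_comp_prod
    simp only [eval, tensorPow, tensorPowOne, tensorPowTwo, standardForm,
      iteratedProd, iteratedCoprod] at h
    refine (cancel_epi (λ_ A).hom).1 ((cancel_mono (λ_ A).inv).1 ?_)
    exact Eq.trans (by simp) (h.trans (by simp))
  cup_eq := by
    have h := hS.eval_eq (m := 2) (n := 0) isConnected_cup isConnected_prod_comp_counit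
    simp only [eval, tensorPow, tensorPowOne, tensorPowTwo] at h
    refine (cancel_epi ((λ_ A).hom ▷ A)).1 ((cancel_mono (𝟙 (𝟙_ C))).1 ?_)
    exact Eq.trans (by simp) (h.trans (by simp [counit]))
  cap_eq := by
    have h := hS.eval_eq (m := 0) (n := 2) isConnected_cap isConnected_unit_comp_coprod
    simp only [eval, tensorPow, tensorPowOne, tensorPowTwo] at h
    refine (cancel_epi (𝟙 (𝟙_ C))).1 ((cancel_mono ((λ_ A).inv ▷ A)).1 ?_)
    exact Eq.trans (by simp) (h.trans (by simp [unit]))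

end SpiderOperations

/-! ### The bijection -/

namespace SpecialFrobeniusStructure

variable {C : Type u} [Category.{v} C] [MonoidalCategory C] {A : C}

/-- The four operations of a special Frobenius algebra. -/
def toSpiderOperations (F : SpecialFrobeniusStructure A) : SpiderOperations A where
  cup := F.mul ≫ F.counit
  cap := F.one ≫ F.comul
  prod := F.mul
  coprod := F.comul

theorem unit_toSpiderOperations (F : SpecialFrobeniusStructure A) :
    F.toSpiderOperations.unit = F.one := by
  simp [SpiderOperations.unit, toSpiderOperations, F.special]

theorem counit_toSpiderOperations (F : SpecialFrobeniusStructure A) :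
    F.toSpiderOperations.counit = F.counit := by
  simp [SpiderOperations.counit, toSpiderOperations, reassoc_of% F.special]

theorem isSpecialFrobenius (F : SpecialFrobeniusStructure A) :
    F.toSpiderOperations.IsSpecialFrobenius where
  unit_prod := F.unit_toSpiderOperations ▸ F.one_mul
  prod_unit := F.unit_toSpiderOperations ▸ F.mul_one
  prod_assoc := F.mul_assoc
  coprod_counit_left := F.counit_toSpiderOperations ▸ F.counit_comul
  coprod_counit_right := F.counit_toSpiderOperations ▸ F.comul_counit
  coprod_assoc := F.comul_assoc
  frobenius_left := F.frobenius_left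
  frobenius_right := F.frobenius_right
  special := F.special
  cup_eq := F.counit_toSpiderOperations.symm ▸ rfl
  cap_eq := F.unit_toSpiderOperations.symm ▸ rfl

end SpecialFrobeniusStructure

/-- The special Frobenius algebra with given product and coproduct, the unit `prod ∘ cap` and the
counit `cup ∘ coprod`. -/
def SpiderOperations.IsSpecialFrobenius.toStructure {C : Type u} [Category.{v} C]
    [MonoidalCategory C] {A : C} {S : SpiderOperations A} (hS : S.IsSpecialFrobenius) :
    SpecialFrobeniusStructure A where
  one := S.unit
  mul := S.prod
  one_mul := hS.unit_prod
  mul_one := hS.prod_unit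
  mul_assoc := hS.prod_assoc
  counit := S.counit
  comul := S.coprod
  counit_comul := hS.coprod_counit_left
  comul_counit := hS.coprod_counit_right
  comul_assoc := hS.coprod_assoc
  frobenius_left := hS.frobenius_left
  frobenius_right := hS.frobenius_right
  special := hS.special

/-- Special Frobenius algebra structures are equivalent to operations that satisfy the planar
spider property. -/
def SpecialFrobeniusStructure.equivPlanarSpider {C : Type u} [Category.{v} C]
    [MonoidalCategory C] (A : C) :
    SpecialFrobeniusStructure A ≃ {S : SpiderOperations A // S.IsPlanarSpider} where
  toFun F := ⟨F.toSpiderOperations, F.isSpecialFrobenius.isPlanarSpider⟩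
  invFun S := S.2.isSpecialFrobenius.toStructure
  left_inv F := by
    have h := F.unit_toSpiderOperations
    -- Product and coproduct are unchanged by the round trip; speciality, through `h` and `h'`,
    -- recovers the unit and the counit.
    have h' := F.counit_toSpiderOperations
    obtain ⟨⟨_, _⟩, ⟨_, _⟩⟩ := F
    simp only [SpiderOperations.IsSpecialFrobenius.toStructure, h, h']
    rfl
  right_inv S := Subtype.ext <| SpiderOperations.ext S.2.isSpecialFrobenius.cup_eq.symm
    S.2.isSpecialFrobenius.cap_eq.symm rfl rfl

theorem theorem2p2 {C : Type u} [Category.{v} C] [MonoidalCategory C] (A : C) :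
    ∃ e : SpecialFrobeniusStructure A ≃ {S : SpiderOperations A // S.IsPlanarSpider},
      (∀ F : SpecialFrobeniusStructure A,
        (e F).1.cup = F.mul ≫ F.counit ∧
        (e F).1.cap = F.one ≫ F.comul ∧
        (e F).1.prod = F.mul ∧
        (e F).1.coprod = F.comul) ∧
      (∀ S : {S : SpiderOperations A // S.IsPlanarSpider},
        (e.symm S).mul = S.1.prod ∧
        (e.symm S).comul = S.1.coprod ∧
        (e.symm S).one = S.1.cap ≫ S.1.prod ∧
        (e.symm S).counit = S.1.coprod ≫ S.1.cup) :=
  ⟨SpecialFrobeniusStructure.equivPlanarSpider A, fun _ => ⟨rfl, rfl, rfl, rfl⟩,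
    fun _ => ⟨rfl, rfl, rfl, rfl⟩⟩
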